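/- Let $q$ be a power of $2$ (with $q\ge 2$), let $F$ be an algebraically closed field of characteristic $2$, let $\mathbf G$ be the simply connected simple algebraic group over $F$ of type $A_n$ ($n\ge1$), $C_n$ ($n>1$) or $D_n$ ($n>3$), that is, $\mathbf G=\mathrm{SL}_{n+1}(F)$, $\mathrm{Sp}_{2n}(F)$ or $\mathrm{Spin}_{2n}(F)$, and let $G\subset\mathbf G$ be the finite group of Lie type $A_n(q)=\mathrm{SL}_{n+1}(q)$, $C_n(q)=\mathrm{Sp}_{2n}(q)$, respectively $D_n^{\pm}(q)=\mathrm{Spin}_{2n}^{\pm}(q)$ (either sign). Let $\omega_1,\dots,\omega_n$ be the fundamental weights of $\mathbf G$ (in the standard Bourbaki numbering) with respect to a maximal torus, and let $V$ be an irreducible (finite-dimensional, rational) $\mathbf G$-module. Suppose that one of the following holds: (1) $\mathbf G$ is of type $A_n$ and there are natural numbers $m_1,m_2$ and $i\in\{1,\dots,n\}$ such that $m_1\big((q-1)\omega_i+\omega_1+\omega_n\big)$ and $m_2(q-1)\omega_i$ are weights of $V$; (2) $\mathbf G$ is of type $C_n$ $(n>1)$ or $D_n$ $(n>3)$ and there are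 natural numbers $m_1,m_2,m_3$ such that $m_1(q+1)\omega_1$, $m_2(q-1)\omega_1$ and $m_3\big((q-1)\omega_1+\omega_2\big)$ are weights of $V$. Then every semisimple element $g\in G$ has eigenvalue $1$ on $V$. -/

import Mathlib

noncomputable section

namespace Unisingular

/-! ### Linear algebraic groups inside the unit group of a finite-dimensional algebra

All the algebraic groups below are Zariski closed subgroups `𝒢` of `Aˣ`, where `A` is a
finite-dimensional algebra over an algebraically closed field `F`: a matrix algebra, or a
Clifford algebra. -/

section General

variable {F : Type*} [Field F] {A : Type*} [Ring A] [Algebra F A]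
  {V : Type*} [AddCommGroup V] [Module F V]

/-- The coordinate ring of `𝒢 ≤ Aˣ`: the `F`-algebra of functions generated by the linear
coordinates of `g` and of `g⁻¹`. -/
def regularFunctions (F : Type*) [Field F] {A : Type*} [Ring A] [Algebra F A]
    (𝒢 : Subgroup Aˣ) : Subalgebra F (𝒢 → F) :=
  Algebra.adjoin F
    ({f | ∃ φ : Module.Dual F A, f = fun g : 𝒢 => φ ((g : Aˣ) : A)} ∪
     {f | ∃ φ : Module.Dual F A, f = fun g : 𝒢 => φ ((g⁻¹ : Aˣ) : A)})

/-- A representation of `𝒢` is rational if its matrix coefficients are regular functions. -/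
def IsRational {𝒢 : Subgroup Aˣ} (ρ : Representation F 𝒢 V) : Prop :=
  ∀ (φ : Module.Dual F V) (v : V), (fun g : 𝒢 => φ (ρ g v)) ∈ regularFunctions F 𝒢

/-- `g` is semisimple in the sense of Jordan decomposition: it acts semisimply in the faithful
rational representation of `Aˣ` on `A` by left multiplication. -/
def IsSemisimpleElement (F : Type*) [Field F] {A : Type*} [Ring A] [Algebra F A]
    (g : Aˣ) : Prop :=
  Module.End.IsSemisimple (LinearMap.mulLeft F (g : A))

/-- The group of characters of `T`, written additively. -/
abbrev CharGroup (F : Type*) [Field F] (T : Type*) [Group T] : Type _ := Additive (T →* Fˣ)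

/-- `χ` is a weight of `ρ` with respect to the torus `T`: its weight space is nonzero. -/
def IsWeight {G : Type*} [Group G] (T : Subgroup G) (ρ : Representation F G V)
    (χ : CharGroup F T) : Prop :=
  ∃ v : V, v ≠ 0 ∧ ∀ t : T, ρ (t : G) v = ((χ.toMul t : Fˣ) : F) • v

theorem conj_mul {g h : Aˣ} {v : A} {a b : Fˣ}
    (hg : (g : A) * v * ((g⁻¹ : Aˣ) : A) = (a : F) • v)
    (hh : (h : A) * v * ((h⁻¹ : Aˣ) : A) = (b : F) • v) :
    ((g * h : Aˣ) : A) * v * (((g * h)⁻¹ : Aˣ) : A) = ((a * b : Fˣ) : F) • v := by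
  have h1 : ((g * h : Aˣ) : A) * v * (((g * h)⁻¹ : Aˣ) : A)
      = (g : A) * ((h : A) * v * ((h⁻¹ : Aˣ) : A)) * ((g⁻¹ : Aˣ) : A) := by
    simp only [mul_inv_rev, Units.val_mul, mul_assoc]
  rw [h1, hh, mul_smul_comm, smul_mul_assoc, hg, smul_smul, Units.val_mul, mul_comm]

theorem conj_inv {g : Aˣ} {v : A} {a : Fˣ}
    (hg : (g : A) * v * ((g⁻¹ : Aˣ) : A) = (a : F) • v) :
    ((g⁻¹ : Aˣ) : A) * v * (((g⁻¹)⁻¹ : Aˣ) : A) = ((a⁻¹ : Fˣ) : F) • v := by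
  have h1 : v = ((a⁻¹ : Fˣ) : F) • ((g : A) * v * ((g⁻¹ : Aˣ) : A)) := by
    rw [hg, smul_smul, Units.inv_mul, one_smul]
  conv_lhs => rw [h1]
  simp [mul_assoc]

/-- `partialSum ε i = ε_1 + ⋯ + ε_i` (with `ε_j` the entry of `ε` at position `j - 1`). -/
def partialSum {X : Type*} [AddCommMonoid X] {N : ℕ} (ε : Fin N → X) (i : ℕ) : X :=
  ∑ j ∈ Finset.univ.filter (fun j : Fin N => (j : ℕ) < i), ε j

end General

/-! ### Diagonal tori of matrix groups -/

section Diagonal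

variable {F : Type*} [Field F] {κ : Type*} [Fintype κ] [DecidableEq κ]

/-- The subgroup of diagonal matrices of a matrix group `𝒢`. -/
def diagTorus (𝒢 : Subgroup (Matrix κ κ F)ˣ) : Subgroup 𝒢 where
  carrier := {g | ∃ d : κ → Fˣ,
    ((g : (Matrix κ κ F)ˣ) : Matrix κ κ F) = Matrix.diagonal fun k => (d k : F)}
  one_mem' := ⟨1, by ext i j; simp [Matrix.one_apply, Matrix.diagonal_apply]⟩
  mul_mem' := by
    rintro a b ⟨d, hd⟩ ⟨e, he⟩
    exact ⟨d * e, by simp [hd, he, Matrix.diagonal_mul_diagonal]⟩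
  inv_mem' := by
    rintro a ⟨d, hd⟩
    refine ⟨d⁻¹, ?_⟩
    have h : ((a : (Matrix κ κ F)ˣ) : Matrix κ κ F) *
        Matrix.diagonal (fun k => ((d⁻¹) k : F)) = 1 := by
      rw [hd, Matrix.diagonal_mul_diagonal]
      ext i j
      simp [Matrix.one_apply, Matrix.diagonal_apply]
    rw [Subgroup.coe_inv]
    exact Units.inv_eq_of_mul_eq_one_right h

/-- The character sending a diagonal matrix to its `k`-th diagonal entry. -/
def diagChar (𝒢 : Subgroup (Matrix κ κ F)ˣ) (k : κ) : CharGroup F (diagTorus 𝒢) :=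
  Additive.ofMul <| MonoidHom.toHomUnits
    { toFun := fun t => (((t : 𝒢) : (Matrix κ κ F)ˣ) : Matrix κ κ F) k k
      map_one' := by simp
      map_mul' := by
        rintro ⟨a, d, hd⟩ ⟨b, e, he⟩
        simp [hd, he] }

end Diagonal

/-! ### Type `A_n`: `SL_{n+1}` -/

section TypeA

variable (F : Type*) [Field F] (n : ℕ)

/-- The simply connected simple algebraic group `SL_{n+1}(F)` of type `A_n`. -/
def groupA : Subgroup (Matrix (Fin (n + 1)) (Fin (n + 1)) F)ˣ :=
  MonoidHom.ker (Matrix.GeneralLinearGroup.det (n := Fin (n + 1)) (R := F))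

/-- The maximal torus of diagonal matrices of `SL_{n+1}(F)`. -/
abbrev torusA : Subgroup (groupA F n) := diagTorus (groupA F n)

/-- The fundamental weight `ω_i = ε_1 + ⋯ + ε_i`, `1 ≤ i ≤ n`, where `ε_j` is the `j`-th diagonal
entry; the simple roots are `ε_j - ε_{j+1}`. -/
def omegaA (i : ℕ) : CharGroup F (torusA F n) :=
  partialSum (diagChar (groupA F n)) i

/-- `SL_{n+1}(q)`: the elements of `SL_{n+1}(F)` with entries in `𝔽_q`. -/
def finiteA (q : ℕ) : Set (groupA F n) :=
  {g | ∀ i j, ((g : (Matrix (Fin (n + 1)) (Fin (n + 1)) F)ˣ) :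
    Matrix (Fin (n + 1)) (Fin (n + 1)) F) i j ^ q =
      ((g : (Matrix (Fin (n + 1)) (Fin (n + 1)) F)ˣ) :
        Matrix (Fin (n + 1)) (Fin (n + 1)) F) i j}

end TypeA

/-! ### Type `C_n`: `Sp_{2n}` -/

section TypeC

variable (F : Type*) [Field F] (n : ℕ)

/-- The simply connected simple algebraic group `Sp_{2n}(F)` of type `C_n`. -/
def groupC : Subgroup (Matrix (Fin n ⊕ Fin n) (Fin n ⊕ Fin n) F)ˣ :=
  (Matrix.symplecticGroup (Fin n) F).units

/-- The maximal torus of diagonal matrices of `Sp_{2n}(F)`, that is, of the matrices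
`diag(a_1, …, a_n, a_1⁻¹, …, a_n⁻¹)`. -/
abbrev torusC : Subgroup (groupC F n) := diagTorus (groupC F n)

/-- The fundamental weight `ω_i = ε_1 + ⋯ + ε_i`, `1 ≤ i ≤ n`, where `ε_j` is the `j`-th of the
first `n` diagonal entries; the simple roots are `ε_j - ε_{j+1}` (`j < n`) and `2 ε_n`. -/
def omegaC (i : ℕ) : CharGroup F (torusC F n) :=
  partialSum (fun j => diagChar (groupC F n) (Sum.inl j)) i

/-- `Sp_{2n}(q)`: the elements of `Sp_{2n}(F)` with entries in `𝔽_q`. -/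
def finiteC (q : ℕ) : Set (groupC F n) :=
  {g | ∀ i j, ((g : (Matrix (Fin n ⊕ Fin n) (Fin n ⊕ Fin n) F)ˣ) :
    Matrix (Fin n ⊕ Fin n) (Fin n ⊕ Fin n) F) i j ^ q =
      ((g : (Matrix (Fin n ⊕ Fin n) (Fin n ⊕ Fin n) F)ˣ) :
        Matrix (Fin n ⊕ Fin n) (Fin n ⊕ Fin n) F) i j}

end TypeC

/-! ### Type `D_n`: `Spin_{2n}` -/

section TypeD

variable (F : Type*) [Field F] (n : ℕ)

/-- The split quadratic form `(x, y) ↦ x_1 y_1 + ⋯ + x_n y_n` on `F^{2n}`. -/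
def splitForm : QuadraticForm F ((Fin n → F) × (Fin n → F)) :=
  ∑ i : Fin n, QuadraticMap.linMulLin
    ((LinearMap.proj i : (Fin n → F) →ₗ[F] F) ∘ₗ LinearMap.fst F (Fin n → F) (Fin n → F))
    ((LinearMap.proj i : (Fin n → F) →ₗ[F] F) ∘ₗ LinearMap.snd F (Fin n → F) (Fin n → F))

theorem splitForm_apply (v : (Fin n → F) × (Fin n → F)) :
    splitForm F n v = ∑ i, v.1 i * v.2 i := by
  simp [splitForm]

/-- The bilinear form `((x, y), (x', y')) ↦ ∑ x_i y'_i`, with diagonal the split form. -/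
def splitBilin : LinearMap.BilinForm F ((Fin n → F) × (Fin n → F)) :=
  ∑ i : Fin n, (LinearMap.mul F F).compl₁₂
    ((LinearMap.proj i : (Fin n → F) →ₗ[F] F) ∘ₗ LinearMap.fst F (Fin n → F) (Fin n → F))
    ((LinearMap.proj i : (Fin n → F) →ₗ[F] F) ∘ₗ LinearMap.snd F (Fin n → F) (Fin n → F))

/-- The Clifford algebra of the split form. -/
abbrev Cl : Type _ := CliffordAlgebra (splitForm F n)

/-- The Clifford algebra is compared with the exterior algebra, so that vectors embed into it. -/
theorem ι_ne_zero {v : (Fin n → F) × (Fin n → F)} (hv : v ≠ 0) :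
    CliffordAlgebra.ι (splitForm F n) v ≠ 0 := by
  have h : LinearMap.BilinMap.toQuadraticMap (-(splitBilin F n)) = 0 - splitForm F n := by
    ext w
    simp [splitBilin, splitForm_apply]
  intro h0
  have h1 := CliffordAlgebra.changeForm_ι h v
  rw [h0, map_zero] at h1
  exact hv ((ExteriorAlgebra.ι_eq_zero_iff v).1 h1.symm)

/-- The simply connected simple algebraic group `Spin_{2n}(F)` of type `D_n`. -/
def groupD : Subgroup (Cl F n)ˣ := (spinGroup (splitForm F n)).units

/-- The image in the Clifford algebra of the `i`-th vector of the first half of the standard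
hyperbolic basis. -/
def vecE (i : Fin n) : Cl F n := CliffordAlgebra.ι (splitForm F n) (Pi.single i 1, 0)

/-- The image in the Clifford algebra of the `i`-th vector of the second half of the standard
hyperbolic basis. -/
def vecF (i : Fin n) : Cl F n := CliffordAlgebra.ι (splitForm F n) (0, Pi.single i 1)

variable {F n} in
theorem vecE_ne_zero (i : Fin n) : vecE F n i ≠ 0 :=
  ι_ne_zero F n fun h => by
    have := congrFun (congrArg Prod.fst h) i
    simp at this

/-- The maximal torus of `Spin_{2n}(F)` of the elements that act by conjugation on the space
`F^{2n}` through diagonal matrices `diag(a_1, …, a_n, a_1⁻¹, …, a_n⁻¹)`; it is the inverse image of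
the diagonal torus of the special orthogonal group. -/
def torusD : Subgroup (groupD F n) where
  carrier := {g | ∀ i, ∃ a : Fˣ,
    ((g : (Cl F n)ˣ) : Cl F n) * vecE F n i * ((g⁻¹ : (Cl F n)ˣ) : Cl F n)
        = (a : F) • vecE F n i ∧
    ((g : (Cl F n)ˣ) : Cl F n) * vecF F n i * ((g⁻¹ : (Cl F n)ˣ) : Cl F n)
        = ((a⁻¹ : Fˣ) : F) • vecF F n i}
  one_mem' := fun i => ⟨1, by simp⟩
  mul_mem' := by
    intro g h hg hh i
    obtain ⟨a, ha, ha'⟩ := hg i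
    obtain ⟨b, hb, hb'⟩ := hh i
    exact ⟨a * b, conj_mul ha hb, by rw [mul_inv]; exact conj_mul ha' hb'⟩
  inv_mem' := by
    intro g hg i
    obtain ⟨a, ha, ha'⟩ := hg i
    exact ⟨a⁻¹, conj_inv ha, conj_inv ha'⟩

variable {F n} in
theorem torusD_eigenvalue_unique {g : Cl F n} {i : Fin n} {a b : Fˣ}
    (ha : g = (a : F) • vecE F n i) (hb : g = (b : F) • vecE F n i) : a = b :=
  Units.ext (smul_left_injective F (vecE_ne_zero i) (ha.symm.trans hb))

/-- The character `ε_i` of the maximal torus: `ε_i(t)` is the eigenvalue of `t` on the `i`-th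
vector of the first half of the standard hyperbolic basis. -/
def epsD (i : Fin n) : CharGroup F (torusD F n) :=
  Additive.ofMul
    { toFun := fun t => (t.2 i).choose
      map_one' := torusD_eigenvalue_unique ((1 : torusD F n).2 i).choose_spec.1 (by simp)
      map_mul' := fun s t => torusD_eigenvalue_unique ((s * t).2 i).choose_spec.1
        (conj_mul (s.2 i).choose_spec.1 (t.2 i).choose_spec.1) }

theorem epsD_spec (i : Fin n) (t : torusD F n) :
    (((t : groupD F n) : (Cl F n)ˣ) : Cl F n) * vecE F n i *
      ((((t : groupD F n) : (Cl F n)ˣ)⁻¹ : (Cl F n)ˣ) : Cl F n) =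
      (((epsD F n i).toMul t : Fˣ) : F) • vecE F n i :=
  (t.2 i).choose_spec.1

/-- The fundamental weight `ω_i = ε_1 + ⋯ + ε_i`, for `1 ≤ i ≤ n - 2`; the simple roots are
`ε_j - ε_{j+1}` (`j < n`) and `ε_{n-1} + ε_n`. (The two remaining fundamental weights, those of
the half-spin representations, have another form and are not needed.) -/
def omegaD (i : ℕ) : CharGroup F (torusD F n) :=
  partialSum (epsD F n) i

/-- The split `𝔽_q`-form of the quadratic space `F^{2n}`: the vectors with coordinates in
`𝔽_q`. -/
def formPlus (q : ℕ) : Set ((Fin n → F) × (Fin n → F)) :=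
  {v | ∀ i, v.1 i ^ q = v.1 i ∧ v.2 i ^ q = v.2 i}

/-- The non-split `𝔽_q`-form of the quadratic space `F^{2n}`: the vectors `(x, y)` whose
coordinates `x_i, y_i`, `i < n`, are in `𝔽_q`, and for which `x_n ∈ 𝔽_{q^2}` and `y_n = x_n ^ q`.
On it the quadratic form is `x_1 y_1 + ⋯ + x_{n-1} y_{n-1} + N(x_n)`, with `N` the norm of
`𝔽_{q^2}` over `𝔽_q`. -/
def formMinus (q : ℕ) : Set ((Fin n → F) × (Fin n → F)) :=
  {v | ∀ i : Fin n, if (i : ℕ) + 1 = n then v.1 i ^ q = v.2 i ∧ v.2 i ^ q = v.1 i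
    else v.1 i ^ q = v.1 i ∧ v.2 i ^ q = v.2 i}

/-- The Clifford algebra over `𝔽_q` of an `𝔽_q`-form `W` of the quadratic space `F^{2n}`: the
subring of the Clifford algebra over `F` generated by `𝔽_q` and by the vectors in `W`. -/
def rationalClifford (q : ℕ) (W : Set ((Fin n → F) × (Fin n → F))) : Subring (Cl F n) :=
  Subring.closure (algebraMap F (Cl F n) '' {c | c ^ q = c} ∪ CliffordAlgebra.ι (splitForm F n) '' W)

/-- The group of `𝔽_q`-points of `Spin_{2n}` for the `𝔽_q`-structure given by an `𝔽_q`-form `W` of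
the quadratic space. -/
def finiteSpin (q : ℕ) (W : Set ((Fin n → F) × (Fin n → F))) : Set (groupD F n) :=
  {g | ((g : (Cl F n)ˣ) : Cl F n) ∈ rationalClifford F n q W}

/-- `Spin⁺_{2n}(q)`, the group `D⁺_n(q)` (for even `q`). -/
def finiteDPlus (q : ℕ) : Set (groupD F n) := finiteSpin F n q (formPlus F n q)

/-- `Spin⁻_{2n}(q)`, the group `D⁻_n(q)` (for even `q`). -/
def finiteDMinus (q : ℕ) : Set (groupD F n) := finiteSpin F n q (formMinus F n q)

end TypeD

end Unisingular

end

open Unisingular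

/-!
If `g h = h t` with `t` in the maximal torus, and some weight is trivial on `t`, then `h` carries a
weight vector to a fixed vector of `g` (`hasEigenvalue_one_of_weight`). So a semisimple `g` is
conjugated into the torus, and the freedom in ordering its eigenvalues (the Weyl group) is used to
make one of the given weights trivial on the result. What makes this possible is that `g` is
defined over `𝔽_q`, so that the `q`-th power map permutes the eigenvalues of `g` in the natural
representation.

For `SL_{n+1}`, the eigenvalues `t_k` satisfy `t_{σ k} = t_k ^ q` for a permutation `σ`. For each
`i` some set `J` of `i` indices has `σ J = J` or `σ J = (J \ {a}) ∪ {b}`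
(`exists_card_eq_almost_stable`). If the eigenvalues are ordered so that `J` comes first, with `a`
in the first place and `b` in the last, then in the first case `(q - 1) ω_i` and in the second case
`(q - 1) ω_i + ω_1 + ω_n = (q - 1) ω_i + ε_1 - ε_{n+1}` is trivial on the resulting diagonal matrix.

For `Sp_{2n}` and `Spin_{2n}` there is a hyperbolic basis of eigenvectors of the natural module, with
eigenvalues `a_i` and `a_i⁻¹` (`exists_isHyperbolicEigenbasis`). Now `a_1 ^ q` is again an eigenvalue.
If it is `a_1` or `a_1⁻¹`, then `(q - 1) ω_1` or `(q + 1) ω_1` is trivial; otherwise the basis can be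
rearranged so that it is `a_2⁻¹`, and `(q - 1) ω_1 + ω_2 = q ε_1 + ε_2` is trivial
(`IsHyperbolicEigenbasis.exists_frobenius_ordered`).

For `Spin_{2n}` two more things are needed. The `q`-th power of an eigenvalue is an eigenvalue since
the Frobenius map of the quadratic space extends to a semilinear ring endomorphism of the Clifford
algebra that fixes `g` (`exists_ringHom_of_semilinear`). And the hyperbolic basis has to be reached
from the standard one by an element of the spin group: Witt's theorem
(`exists_reflectionMonoid_apply_eq`) gives a product of reflections, which lifts to the Clifford
algebra; if the number of reflections is odd, one more reflection, exchanging the last pair of basis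
vectors, makes it even without affecting `ε_1` and `ε_2`.
-/

namespace Unisingular

open Module

/-! ### Weights and eigenvalues -/

/-- A conjugate of a torus element `t` acts with eigenvalue `1` as soon as some weight is trivial
on `t`: translate the weight vector. -/
theorem hasEigenvalue_one_of_weight {F V G : Type*} [Field F] [AddCommGroup V] [Module F V]
    [Group G] {T : Subgroup G} {ρ : Representation F G V} {χ : CharGroup F T}
    (hχ : IsWeight T ρ χ) {g h : G} (t : T) (hg : g * h = h * t) (ht : χ.toMul t = 1) :
    Module.End.HasEigenvalue (ρ g) 1 := by
  obtain ⟨v, hv, hw⟩ := hχ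
  refine Module.End.hasEigenvalue_of_hasEigenvector (x := ρ h v)
    ⟨Module.End.mem_eigenspace_iff.2 ?_, fun h0 => hv ?_⟩
  · rw [← Module.End.mul_apply, ← map_mul, hg, map_mul, Module.End.mul_apply, hw t, ht]
    simp
  · simpa using congrArg (ρ h⁻¹) h0

theorem toMul_partialSum {F T : Type*} [Field F] [Group T] {N : ℕ} (ε : Fin N → CharGroup F T)
    (i : ℕ) (t : T) : (partialSum ε i).toMul t =
      ∏ j ∈ Finset.univ.filter (fun j : Fin N => (j : ℕ) < i), (ε j).toMul t := by
  rw [partialSum, toMul_sum, MonoidHom.finsetProd_apply]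

theorem toMul_nsmul_apply {F T : Type*} [Field F] [Group T] (m : ℕ) (χ : CharGroup F T) (t : T) :
    (m • χ).toMul t = (χ.toMul t) ^ m := by
  rw [toMul_nsmul, MonoidHom.pow_apply]

theorem toMul_add_apply {F T : Type*} [Field F] [Group T] (χ ψ : CharGroup F T) (t : T) :
    (χ + ψ).toMul t = χ.toMul t * ψ.toMul t := by
  rw [toMul_add, MonoidHom.mul_apply]

/-! ### Semisimple endomorphisms over an algebraically closed field -/

section Semisimple

variable {F : Type*} [Field F] {A : Type*} [Ring A] [Algebra F A]
  {M : Type*} [AddCommGroup M] [Module F M]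

theorem exists_squarefree_aeval_eq_zero [FiniteDimensional F A] {g : Aˣ}
    (hg : IsSemisimpleElement F g) :
    ∃ p : Polynomial F, Squarefree p ∧ Polynomial.aeval (g : A) p = 0 := by
  refine ⟨_, hg.minpoly_squarefree, ?_⟩
  have h := minpoly.aeval F (LinearMap.mulLeft F (g : A))
  have h2 : LinearMap.mulLeft F (g : A) = Algebra.lmul F A (g : A) := rfl
  rw [h2, Polynomial.aeval_algHom_apply, ← h2] at h
  simpa using LinearMap.congr_fun h 1

theorem iSup_eigenspace_eq_top [IsAlgClosed F] [FiniteDimensional F M] {f : End F M}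
    (hf : f.IsSemisimple) : ⨆ μ, f.eigenspace μ = ⊤ := by
  rw [← Module.End.iSup_maxGenEigenspace_eq_top f]
  exact iSup_congr fun μ => (hf.isFinitelySemisimple.maxGenEigenspace_eq_eigenspace μ).symm

theorem exists_basis_eigenvectors [IsAlgClosed F] [FiniteDimensional F M] {f : End F M}
    (hf : f.IsSemisimple) {κ : Type*} (b₀ : Basis κ F M) :
    ∃ (b : Basis κ F M) (t : κ → F), ∀ k, f (b k) = t k • b k := by
  classical
  have hi := DirectSum.isInternal_submodule_of_iSupIndep_of_iSup_eq_top
    f.eigenspaces_iSupIndep (iSup_eigenspace_eq_top hf)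
  let c := hi.collectedBasis fun μ => Module.Free.chooseBasis F (f.eigenspace μ)
  let e := c.indexEquiv b₀
  refine ⟨c.reindex e, fun k => (e.symm k).1, fun k => ?_⟩
  have h := hi.collectedBasis_mem (fun μ => Module.Free.chooseBasis F (f.eigenspace μ)) (e.symm k)
  rw [Basis.reindex_apply]
  exact Module.End.mem_eigenspace_iff.1 h

/-- A linear map intertwining two endomorphisms intertwines their polynomials. -/
theorem apply_aeval_of_intertwining {M' : Type*} [AddCommGroup M'] [Module F M'] {f : End F M}
    {f' : End F M'} (φ : M →ₗ[F] M') (h : ∀ x, φ (f x) = f' (φ x)) (p : Polynomial F) (x : M) :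
    φ (Polynomial.aeval f p x) = Polynomial.aeval f' p (φ x) := by
  induction p using Polynomial.induction_on' generalizing x with
  | add p q hp hq => simp [hp, hq]
  | monomial n a =>
    have hn : ∀ n : ℕ, ∀ x, φ ((f ^ n) x) = (f' ^ n) (φ x) := by
      intro n
      induction n with
      | zero => simp
      | succ n ih => intro x; rw [pow_succ, pow_succ, End.mul_apply, End.mul_apply, ih, h]
    simp [Polynomial.aeval_monomial, hn, Module.algebraMap_end_apply]

theorem isSemisimple_toLin' {κ : Type*} [Fintype κ] [DecidableEq κ] {g : (Matrix κ κ F)ˣ}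
    (hg : IsSemisimpleElement F g) :
    Module.End.IsSemisimple (Matrix.toLin' (g : Matrix κ κ F)) := by
  obtain ⟨p, hp, h⟩ := exists_squarefree_aeval_eq_zero hg
  refine Module.End.isSemisimple_of_squarefree_aeval_eq_zero hp ?_
  have h2 := Polynomial.aeval_algHom_apply
    (Matrix.toLinAlgEquiv' (R := F) (n := κ)).toAlgHom (g : Matrix κ κ F) p
  rw [h, map_zero] at h2
  exact h2

end Semisimple

/-! ### Conjugation into the diagonal torus -/

section Diagonal

variable {F : Type*} [Field F] {κ : Type*} [Fintype κ] [DecidableEq κ]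

/-- If `g P = P diag(d)` inside a matrix group, then `P⁻¹ g P` is an element of the diagonal torus
on which the characters `ε_k` take the values `d_k`. -/
theorem exists_diagTorus_of_mul_eq {𝒢 : Subgroup (Matrix κ κ F)ˣ} {g P : 𝒢} {d : κ → F}
    (h : ((g : (Matrix κ κ F)ˣ) : Matrix κ κ F) * ((P : (Matrix κ κ F)ˣ) : Matrix κ κ F) =
      ((P : (Matrix κ κ F)ˣ) : Matrix κ κ F) * Matrix.diagonal d) :
    ∃ t : diagTorus 𝒢, g * P = P * t ∧ ∀ k, (((diagChar 𝒢 k).toMul t : Fˣ) : F) = d k := by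
  have hD : (((P⁻¹ * g * P : 𝒢) : (Matrix κ κ F)ˣ) : Matrix κ κ F) = Matrix.diagonal d := by
    push_cast
    rw [mul_assoc, h, ← mul_assoc]
    simp
  have hu : IsUnit (Matrix.diagonal d) := hD ▸ Units.isUnit _
  rw [Matrix.isUnit_iff_isUnit_det, Matrix.det_diagonal, isUnit_iff_ne_zero,
    Finset.prod_ne_zero_iff] at hu
  refine ⟨⟨P⁻¹ * g * P, fun k => Units.mk0 (d k) (hu k (Finset.mem_univ k)), ?_⟩, ?_, fun k => ?_⟩
  · simpa using hD
  · simp [mul_assoc]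
  · change (((P⁻¹ * g * P : 𝒢) : (Matrix κ κ F)ˣ) : Matrix κ κ F) k k = d k
    rw [hD, Matrix.diagonal_apply_eq]

end Diagonal

/-! ### Special linear groups -/

section TypeA

/-- For a permutation `σ` of a finite set and every size `i` there is a set `J` of size `i` such
that `σ J` is `J`, or differs from `J` in one element: take whole cycles of `σ`, and then an
initial arc of one more cycle. -/
theorem exists_card_eq_almost_stable {α : Type*} [Fintype α] [DecidableEq α] (σ : Equiv.Perm α)
    (i : ℕ) (hi : i ≤ Fintype.card α) :
    ∃ J : Finset α, J.card = i ∧ (J.image σ = J ∨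
      ∃ a ∈ J, ∃ b ∉ J, J.image σ = insert b (J.erase a)) := by
  induction i with
  | zero => exact ⟨∅, rfl, Or.inl rfl⟩
  | succ i ih =>
    obtain ⟨J, hJ, h | ⟨a, ha, b, hb, h⟩⟩ := ih (by omega)
    · obtain ⟨x, hx⟩ : ∃ x, x ∉ J := by
        by_contra! hc
        have := Finset.card_eq_iff_eq_univ J |>.2 (Finset.eq_univ_iff_forall.2 hc)
        omega
      refine ⟨insert x J, by simp [hx, hJ], ?_⟩
      by_cases hs : σ x = x
      · left; rw [Finset.image_insert, hs, h]
      · right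
        refine ⟨x, by simp, σ x, ?_, ?_⟩
        · rw [Finset.mem_insert, not_or]
          refine ⟨hs, fun hc => hx ?_⟩
          rw [← h] at hc
          exact (Function.Injective.mem_finset_image σ.injective).1 hc
        · rw [Finset.image_insert, h, Finset.erase_insert hx]
    · refine ⟨insert b J, by simp [hb, hJ], ?_⟩
      have hab : a ≠ b := fun hc => hb (hc ▸ ha)
      have hn : σ b ∉ insert b (J.erase a) := by
        rw [← h]
        exact fun hc => hb ((Function.Injective.mem_finset_image σ.injective).1 hc)
      rw [Finset.image_insert, h]
      by_cases hs : σ b = a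
      · left
        ext x
        simp only [Finset.mem_insert, Finset.mem_erase]
        grind
      · right
        refine ⟨a, by simp [ha], σ b, ?_, ?_⟩
        · simp only [Finset.mem_insert, Finset.mem_erase, not_or] at hn ⊢
          exact ⟨hn.1, fun hc => hn.2 ⟨hs, hc⟩⟩
        · ext x
          simp only [Finset.mem_insert, Finset.mem_erase]
          grind

/-- Two families with the same characteristic polynomial `∏ (X - t_k)` differ by a permutation. -/
theorem exists_perm_of_prod_X_sub_C_eq {F κ : Type*} [Field F] [Fintype κ] {s t : κ → F}
    (h : ∏ k, (Polynomial.X - Polynomial.C (s k)) = ∏ k, (Polynomial.X - Polynomial.C (t k))) :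
    ∃ σ : Equiv.Perm κ, ∀ k, t (σ k) = s k := by
  classical
  have h1 : ∀ u : κ → F, (∏ k, (Polynomial.X - Polynomial.C (u k))).roots =
      Finset.univ.val.map u := by
    intro u
    have := Polynomial.roots_multiset_prod_X_sub_C (Finset.univ.val.map u)
    rwa [Multiset.map_map] at this
  have h2 : Finset.univ.val.map s = Finset.univ.val.map t := by rw [← h1, h, h1]
  have h3 : ∀ c, Fintype.card {k // s k = c} = Fintype.card {k // t k = c} := by
    intro c
    have := congrArg (Multiset.count c) h2
    rw [Multiset.count_map, Multiset.count_map] at this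
    rw [Fintype.card_subtype, Fintype.card_subtype]
    simpa [Finset.card_def, Finset.filter_val, eq_comm] using this
  exact ⟨Equiv.ofFiberEquiv fun c => Fintype.equivOfCardEq (h3 c),
    fun k => Equiv.ofFiberEquiv_map _ k⟩

/-- A permutation of `Fin (n + 1)` carrying the first `i` positions onto a given set `J` of size
`i`, the first position to a given element of `J`, and the last one to a given element outside. -/
theorem exists_perm_image_initial {n : ℕ} (J : Finset (Fin (n + 1))) (hJ₁ : 1 ≤ J.card)
    (hJn : J.card ≤ n) {a b : Fin (n + 1)} (ha : a ∈ J) (hb : b ∉ J) :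
    ∃ π : Equiv.Perm (Fin (n + 1)), (∀ k, π k ∈ J ↔ (k : ℕ) < J.card) ∧ π 0 = a ∧
      π (Fin.last n) = b := by
  have hc : Fintype.card {k : Fin (n + 1) // (k : ℕ) < J.card} =
      Fintype.card {k : Fin (n + 1) // k ∈ J} := by
    rw [Fintype.card_subtype, Fintype.card_coe]
    rw [Fin.card_filter_val_lt]
    omega
  let e := Fintype.equivOfCardEq hc
  let π := e.extendSubtype
  have hπ : ∀ k, π k ∈ J ↔ (k : ℕ) < J.card := fun k =>
    ⟨fun h => by_contra fun h' => e.extendSubtype_not_mem k h' h, fun h => e.extendSubtype_mem k h⟩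
  have ha' : ((π.symm a : Fin (n + 1)) : ℕ) < J.card := by rw [← hπ]; simpa
  have hb' : ¬ ((π.symm b : Fin (n + 1)) : ℕ) < J.card := by rw [← hπ]; simpa
  have h0 : ((0 : Fin (n + 1)) : ℕ) = 0 := rfl
  have hl : ((Fin.last n : Fin (n + 1)) : ℕ) = n := rfl
  have h0l : (0 : Fin (n + 1)) ≠ Fin.last n := by
    intro h; have := congrArg Fin.val h; simp at this; omega
  have h0b : (0 : Fin (n + 1)) ≠ π.symm b := by
    intro h; rw [← h] at hb'; omega
  have hla : Fin.last n ≠ π.symm a := by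
    intro h; rw [← h] at ha'; omega
  have hab : π.symm a ≠ π.symm b := fun h => hb (π.symm.injective h ▸ ha)
  refine ⟨π * (Equiv.swap 0 (π.symm a) * Equiv.swap (Fin.last n) (π.symm b)), fun k => ?_, ?_, ?_⟩
  · rw [Equiv.Perm.mul_apply, hπ, Equiv.Perm.mul_apply]
    have hs1 : ∀ k, ((Equiv.swap 0 (π.symm a) k : Fin (n + 1)) : ℕ) < J.card ↔
        (k : ℕ) < J.card := by
      intro k
      rw [Equiv.swap_apply_def]
      split_ifs with h h
      · subst h; omega
      · subst h; omega
      · rfl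
    have hs2 : ∀ k, ((Equiv.swap (Fin.last n) (π.symm b) k : Fin (n + 1)) : ℕ) < J.card ↔
        (k : ℕ) < J.card := by
      intro k
      rw [Equiv.swap_apply_def]
      split_ifs with h h
      · subst h; omega
      · subst h; omega
      · rfl
    rw [hs1, hs2]
  · simp [Equiv.swap_apply_of_ne_of_ne h0l h0b]
  · simp [Equiv.swap_apply_of_ne_of_ne h0b.symm hab.symm]

variable {F : Type*} [Field F] [IsAlgClosed F] {n : ℕ}

/-- The eigenvalues of a diagonalizable matrix with entries fixed by an endomorphism `φ` of the
field are permuted by `φ`. -/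
theorem exists_eigenbasis_perm {κ : Type*} [Fintype κ] [DecidableEq κ] (φ : F →+* F)
    {g : (Matrix κ κ F)ˣ} (hs : IsSemisimpleElement F g)
    (hφ : (g : Matrix κ κ F).map φ = (g : Matrix κ κ F)) :
    ∃ (b : Basis κ F (κ → F)) (t : κ → F) (σ : Equiv.Perm κ),
      (∀ k, (g : Matrix κ κ F).mulVec (b k) = t k • b k) ∧ ∀ k, t (σ k) = φ (t k) := by
  obtain ⟨b, t, hb⟩ := exists_basis_eigenvectors (isSemisimple_toLin' hs) (Pi.basisFun F κ)
  have hchar : (g : Matrix κ κ F).charpoly = ∏ k, (Polynomial.X - Polynomial.C (t k)) := by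
    have h1 := LinearMap.charpoly_toMatrix (Matrix.toLin' (g : Matrix κ κ F)) (Pi.basisFun F κ)
    rw [LinearMap.toMatrix_eq_toMatrix', LinearMap.toMatrix'_toLin'] at h1
    rw [h1, ← Matrix.charpoly_diagonal, ← LinearMap.charpoly_toMatrix _ b]
    congr 1
    ext i j
    rw [LinearMap.toMatrix_apply, hb]
    simp [Finsupp.single_apply, Matrix.diagonal_apply, eq_comm]
    split_ifs with h
    · rw [h]
    · rfl
  have h2 : ∏ k, (Polynomial.X - Polynomial.C (φ (t k))) =
      ∏ k, (Polynomial.X - Polynomial.C (t k)) := by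
    rw [← hchar]
    conv_rhs => rw [← hφ, Matrix.charpoly_map, hchar, Polynomial.map_prod]
    simp
  obtain ⟨σ, hσ⟩ := exists_perm_of_prod_X_sub_C_eq h2
  exact ⟨b, t, σ, hb, hσ⟩

/-- A matrix of `SL_{n+1}` with a basis of eigenvectors is conjugate in `SL_{n+1}` to the diagonal
matrix of the eigenvalues, in the given order. -/
theorem exists_torusA_of_eigenbasis (g : groupA F n)
    (b : Basis (Fin (n + 1)) F (Fin (n + 1) → F)) (t : Fin (n + 1) → F)
    (hb : ∀ k, ((g : (Matrix (Fin (n + 1)) (Fin (n + 1)) F)ˣ) :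
      Matrix (Fin (n + 1)) (Fin (n + 1)) F).mulVec (b k) = t k • b k) :
    ∃ (P : groupA F n) (d : torusA F n), g * P = P * d ∧
      ∀ k, (((diagChar (groupA F n) k).toMul d : Fˣ) : F) = t k := by
  let P₀ : Matrix (Fin (n + 1)) (Fin (n + 1)) F := (Pi.basisFun F _).toMatrix b
  have hdet : P₀.det ≠ 0 := by
    have := (Pi.basisFun F (Fin (n + 1))).invertibleToMatrix b
    exact (Matrix.isUnit_det_of_invertible P₀).ne_zero
  -- `P₀` is rescaled by a scalar to have determinant one
  obtain ⟨c, hc⟩ := IsAlgClosed.exists_pow_nat_eq (P₀.det)⁻¹ (Nat.succ_pos n)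
  have hP : (c • P₀).det = 1 := by
    rw [Matrix.det_smul, Fintype.card_fin, hc, inv_mul_cancel₀ hdet]
  let P : (Matrix (Fin (n + 1)) (Fin (n + 1)) F)ˣ := Matrix.nonsingInvUnit (c • P₀) (by simp [hP])
  have hPmem : P ∈ groupA F n := by
    rw [groupA, MonoidHom.mem_ker]
    exact Units.ext hP
  refine ⟨⟨P, hPmem⟩, exists_diagTorus_of_mul_eq ?_⟩
  change _ * (c • P₀) = (c • P₀) * _
  rw [Matrix.mul_smul, Matrix.smul_mul]
  congr 1
  ext i k
  have := congrFun (hb k) i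
  rw [Matrix.mul_diagonal, Matrix.mul_apply]
  simpa [P₀, Basis.toMatrix_apply, Matrix.mulVec, dotProduct, mul_comm] using this

theorem hasEigenvalue_one_typeA [CharP F 2] {V : Type*} [AddCommGroup V] [Module F V]
    {q k : ℕ} (hq : q = 2 ^ k) (ρ : Representation F (groupA F n) V) {m₁ m₂ i : ℕ}
    (hi₁ : 1 ≤ i) (hin : i ≤ n)
    (hw₁ : IsWeight (torusA F n) ρ
      (m₁ • ((q - 1) • omegaA F n i + omegaA F n 1 + omegaA F n n)))
    (hw₂ : IsWeight (torusA F n) ρ (m₂ • (q - 1) • omegaA F n i))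
    {g : groupA F n} (hg : g ∈ finiteA F n q) (hs : IsSemisimpleElement F g.1) :
    Module.End.HasEigenvalue (ρ g) 1 := by
  have hq1 : q - 1 + 1 = q := Nat.sub_add_cancel (hq ▸ Nat.one_le_two_pow)
  let φ := iterateFrobenius F 2 k
  have hφ : ∀ x, φ x = x ^ q := fun x => by simp [φ, iterateFrobenius_def, hq]
  obtain ⟨b, t, σ, hb, hσ⟩ := exists_eigenbasis_perm φ hs
    (by ext i j; rw [Matrix.map_apply, hφ, hg i j])
  obtain ⟨J, hJ, h⟩ := exists_card_eq_almost_stable σ i (by simp; omega)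
  have hJ0 : J.Nonempty := Finset.card_pos.1 (by omega)
  have hJc : ∃ x, x ∉ J := by
    by_contra! hc
    have := Finset.card_eq_iff_eq_univ J |>.2 (Finset.eq_univ_iff_forall.2 hc)
    simp at this; omega
  obtain ⟨a₀, ha₀⟩ := hJ0
  obtain ⟨b₀, hb₀⟩ := hJc
  -- it suffices to order the eigenvalues so that those in `J` come first
  have key : ∀ a ∈ J, ∀ c ∉ J, ∃ (P : groupA F n) (d : torusA F n), g * P = P * d ∧
      (((omegaA F n i).toMul d : Fˣ) : F) = ∏ j ∈ J, t j ∧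
      (((omegaA F n 1).toMul d : Fˣ) : F) = t a ∧
      (((omegaA F n n).toMul d : Fˣ) : F) * t c = 1 := by
    intro a ha c hc
    obtain ⟨π, hπ, hπa, hπc⟩ := exists_perm_image_initial J (by omega) (by omega) ha hc
    obtain ⟨P, d, hPd, hd⟩ := exists_torusA_of_eigenbasis g (b.reindex π.symm) (t ∘ π)
      (fun k => by simpa using hb (π k))
    refine ⟨P, d, hPd, ?_, ?_, ?_⟩
    · rw [omegaA, toMul_partialSum, Units.coe_prod]
      simp_rw [hd]
      refine Finset.prod_bij (fun k _ => π k) (fun k hk => ?_) (fun k _ l _ h => π.injective h)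
        (fun j hj => ⟨π.symm j, ?_, by simp⟩) (fun _ _ => rfl)
      · rw [hπ, hJ]; simpa using hk
      · have := (hπ (π.symm j)).1 (by simpa using hj)
        simpa [hJ] using this
    · rw [omegaA, toMul_partialSum, Units.coe_prod]
      have : (Finset.univ.filter fun j : Fin (n + 1) => (j : ℕ) < 1) = {0} := by
        ext j
        rw [Finset.mem_filter, Finset.mem_singleton, Fin.ext_iff, Nat.lt_one_iff]
        exact and_iff_right (Finset.mem_univ j)
      rw [this, Finset.prod_singleton, hd, Function.comp_apply, hπa]
    · -- the product of all the diagonal entries is the determinant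
      have hdet : ∏ j, t (π j) = 1 := by
        obtain ⟨e, he⟩ := d.2
        have h2 := congrArg Units.val (MonoidHom.mem_ker.1 (d : groupA F n).2)
        rw [Matrix.GeneralLinearGroup.val_det_apply, Units.val_one] at h2
        rw [he, Matrix.det_diagonal] at h2
        rw [← h2]
        refine Finset.prod_congr rfl fun j _ => ?_
        rw [← Function.comp_apply (f := t) (g := π), ← hd]
        change (((d : groupA F n) : (Matrix (Fin (n + 1)) (Fin (n + 1)) F)ˣ) :
          Matrix (Fin (n + 1)) (Fin (n + 1)) F) j j = _
        rw [he, Matrix.diagonal_apply_eq]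
      rw [omegaA, toMul_partialSum, Units.coe_prod, ← hπc, ← hdet]
      simp_rw [hd]
      rw [← Finset.prod_filter_mul_prod_filter_not Finset.univ fun j : Fin (n + 1) => (j : ℕ) < n]
      congr 1
      have : (Finset.univ.filter fun j : Fin (n + 1) => ¬ (j : ℕ) < n) = {Fin.last n} := by
        ext j; simp [Fin.ext_iff]; omega
      rw [this, Finset.prod_singleton]
  have hpow : (∏ j ∈ J, t j) ^ q = ∏ j ∈ J.image σ, t j := by
    rw [Finset.prod_image fun x _ y _ h => σ.injective h, ← Finset.prod_pow]
    exact Finset.prod_congr rfl fun j _ => by rw [hσ, hφ]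
  have hpow' : (∏ j ∈ J, t j) ^ q = (∏ j ∈ J, t j) ^ (q - 1) * ∏ j ∈ J, t j := by
    conv_lhs => rw [← hq1, pow_succ]
  rcases h with h | ⟨a, ha, c, hc, h⟩
  · obtain ⟨P, d, hPd, h1, -, -⟩ := key a₀ ha₀ b₀ hb₀
    refine hasEigenvalue_one_of_weight hw₂ d hPd ?_
    have hne : ∏ j ∈ J, t j ≠ 0 := h1 ▸ Units.ne_zero _
    rw [h, hpow'] at hpow
    have h3 := mul_eq_right₀ hne |>.1 hpow
    rw [toMul_nsmul_apply, toMul_nsmul_apply]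
    ext
    push_cast
    rw [h1, h3, one_pow]
  · obtain ⟨P, d, hPd, h1, h2, h3⟩ := key a ha c hc
    refine hasEigenvalue_one_of_weight hw₁ d hPd ?_
    have hne : ∏ j ∈ J, t j ≠ 0 := h1 ▸ Units.ne_zero _
    have hca : c ∉ J.erase a := fun h => hc (Finset.mem_of_mem_erase h)
    rw [h, hpow', Finset.prod_insert hca, ← Finset.mul_prod_erase _ _ ha] at hpow
    rw [← Finset.mul_prod_erase _ _ ha] at hne h1
    have h4 : (t a * ∏ j ∈ J.erase a, t j) ^ (q - 1) * t a = t c :=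
      mul_right_cancel₀ (right_ne_zero_of_mul hne) (by rw [← hpow]; ring)
    rw [toMul_nsmul_apply, toMul_add_apply, toMul_add_apply, toMul_nsmul_apply]
    ext
    push_cast
    rw [h1, h2, h4, mul_comm, h3, one_pow]

end TypeA

/-! ### Hyperbolic bases of eigenvectors of isometries -/

section Hyperbolic

variable {F : Type*} [Field F] {E : Type*} [AddCommGroup E] [Module F E] {ι : Type*}

/-- A hyperbolic basis `(e_i, f_i)` of a space with a bilinear form `B` and a quadratic form `Q`:
the vectors are isotropic for `Q`, the pairs are mutually orthogonal, `B(e_i, f_i) = 1`, and nothing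
is orthogonal to all of them. A symplectic basis is the case `Q = 0`. -/
structure IsHyperbolicBasis (B : LinearMap.BilinForm F E) (Q : QuadraticForm F E)
    (e f : ι → E) : Prop where
  map_left : ∀ i, Q (e i) = 0
  map_right : ∀ i, Q (f i) = 0
  left_left : ∀ i j, B (e i) (e j) = 0
  right_right : ∀ i j, B (f i) (f j) = 0
  left_right_self : ∀ i, B (e i) (f i) = 1
  left_right_of_ne : ∀ i j, i ≠ j → B (e i) (f j) = 0
  eq_zero : ∀ x, (∀ i, B x (e i) = 0) → (∀ i, B x (f i) = 0) → x = 0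

/-- A hyperbolic basis of eigenvectors of `s`, with eigenvalues `a_i` and `a_i⁻¹`. -/
structure IsHyperbolicEigenbasis (B : LinearMap.BilinForm F E) (Q : QuadraticForm F E)
    (s : End F E) (e f : ι → E) (a : ι → Fˣ) : Prop extends IsHyperbolicBasis B Q e f where
  apply_left : ∀ i, s (e i) = (a i : F) • e i
  apply_right : ∀ i, s (f i) = (((a i)⁻¹ : Fˣ) : F) • f i

variable {B : LinearMap.BilinForm F E} {Q : QuadraticForm F E} {s : End F E}

theorem isAlt_symm [CharP F 2] (hB : B.IsAlt) (x y : E) : B x y = B y x := by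
  rw [← hB.neg_eq, CharTwo.neg_eq]

theorem IsHyperbolicBasis.comp_equiv {e f : ι → E} (h : IsHyperbolicBasis B Q e f)
    {κ : Type*} (π : κ ≃ ι) : IsHyperbolicBasis B Q (e ∘ π) (f ∘ π) where
  map_left _ := h.map_left _
  map_right _ := h.map_right _
  left_left _ _ := h.left_left _ _
  right_right _ _ := h.right_right _ _
  left_right_self _ := h.left_right_self _
  left_right_of_ne i j hij := h.left_right_of_ne _ _ (π.injective.ne hij)
  eq_zero x h₁ h₂ := h.eq_zero x (fun i => by simpa using h₁ (π.symm i))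
    (fun i => by simpa using h₂ (π.symm i))

theorem IsHyperbolicEigenbasis.comp_equiv {e f : ι → E} {a : ι → Fˣ}
    (h : IsHyperbolicEigenbasis B Q s e f a) {κ : Type*} (π : κ ≃ ι) :
    IsHyperbolicEigenbasis B Q s (e ∘ π) (f ∘ π) (a ∘ π) where
  toIsHyperbolicBasis := h.toIsHyperbolicBasis.comp_equiv π
  apply_left _ := h.apply_left _
  apply_right _ := h.apply_right _

/-- Exchanging the two vectors of one pair of a hyperbolic basis, in characteristic `2`. -/
theorem IsHyperbolicBasis.flip [CharP F 2] [DecidableEq ι] (hB : B.IsAlt) {e f : ι → E}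
    (h : IsHyperbolicBasis B Q e f) (j : ι) :
    IsHyperbolicBasis B Q (Function.update e j (f j)) (Function.update f j (e j)) where
  map_left i := by
    by_cases hi : i = j
    · subst hi; simp [h.map_right]
    · simp [hi, h.map_left]
  map_right i := by
    by_cases hi : i = j
    · subst hi; simp [h.map_left]
    · simp [hi, h.map_right]
  left_left i k := by
    by_cases hi : i = j <;> by_cases hk : k = j
    · subst hi; subst hk; simp [h.right_right]
    · subst hi; simp [hk, isAlt_symm hB (f i), h.left_right_of_ne k i hk]
    · subst hk; simp [hi, h.left_right_of_ne i k hi]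
    · simp [hi, hk, h.left_left]
  right_right i k := by
    by_cases hi : i = j <;> by_cases hk : k = j
    · subst hi; subst hk; simp [h.left_left]
    · subst hi; simp [hk, h.left_right_of_ne i k (Ne.symm hk)]
    · subst hk; simp [hi, isAlt_symm hB (f i), h.left_right_of_ne k i (Ne.symm hi)]
    · simp [hi, hk, h.right_right]
  left_right_self i := by
    by_cases hi : i = j
    · subst hi; simp [isAlt_symm hB (f i), h.left_right_self]
    · simp [hi, h.left_right_self]
  left_right_of_ne i k hik := by
    by_cases hi : i = j <;> by_cases hk : k = j
    · exact absurd (hi.trans hk.symm) hik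
    · subst hi; simp [hk, h.right_right]
    · subst hk; simp [hi, h.left_left]
    · simp [hi, hk, h.left_right_of_ne i k hik]
  eq_zero x h₁ h₂ := by
    refine h.eq_zero x (fun i => ?_) (fun i => ?_)
    · by_cases hi : i = j
      · subst hi; simpa using h₂ i
      · simpa [hi] using h₁ i
    · by_cases hi : i = j
      · subst hi; simpa using h₁ i
      · simpa [hi] using h₂ i

theorem IsHyperbolicEigenbasis.flip [CharP F 2] [DecidableEq ι] (hB : B.IsAlt) {e f : ι → E}
    {a : ι → Fˣ} (h : IsHyperbolicEigenbasis B Q s e f a) (j : ι) :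
    IsHyperbolicEigenbasis B Q s (Function.update e j (f j)) (Function.update f j (e j))
      (Function.update a j (a j)⁻¹) where
  toIsHyperbolicBasis := h.toIsHyperbolicBasis.flip hB j
  apply_left i := by
    by_cases hi : i = j
    · subst hi; simp only [Function.update_self]; exact h.apply_right i
    · simpa [hi] using h.apply_left i
  apply_right i := by
    by_cases hi : i = j
    · subst hi; simp only [Function.update_self, inv_inv]; exact h.apply_left i
    · simpa [hi] using h.apply_right i

/-- Every vector pairs nontrivially with an eigenvector of a semisimple endomorphism. -/
theorem exists_eigenvector_pairing [IsAlgClosed F] [FiniteDimensional F E]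
    (hs : s.IsSemisimple) (hnd : ∀ x, (∀ y, B x y = 0) → x = 0) {x : E} (hx : x ≠ 0) :
    ∃ (μ : F) (y : E), s y = μ • y ∧ B x y = 1 := by
  by_contra! hc
  refine hx (hnd x fun y => ?_)
  have h : (⊤ : Submodule F E) ≤ LinearMap.ker (B x) := by
    rw [← iSup_eigenspace_eq_top hs]
    refine iSup_le fun μ y hy => ?_
    rw [LinearMap.mem_ker]
    by_contra h0
    refine hc μ ((B x y)⁻¹ • y) ?_ ?_
    · rw [map_smul, Module.End.mem_eigenspace_iff.1 hy, smul_comm]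
    · rw [map_smul, smul_eq_mul, inv_mul_cancel₀ h0]
  exact h (Submodule.mem_top (x := y))

theorem map_add_of_polar (hQB : Q.polarBilin = B) (x y : E) : Q (x + y) = Q x + Q y + B x y := by
  rw [← hQB, QuadraticMap.polarBilin_apply_apply, QuadraticMap.map_add Q x y]

variable [IsAlgClosed F] [CharP F 2] [FiniteDimensional F E]

/-- A semisimple isometry has an isotropic eigenvector: an anisotropic eigenvector has eigenvalue
`1`, and spans with another one a nondegenerate plane on which the isometry is trivial. -/
theorem exists_isotropic_eigenvector [Nontrivial E] (hs : s.IsSemisimple) (hB : B.IsAlt)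
    (hnd : ∀ x, (∀ y, B x y = 0) → x = 0) (hsB : ∀ x y, B (s x) (s y) = B x y)
    (hQB : Q = 0 ∨ Q.polarBilin = B) (hsQ : ∀ x, Q (s x) = Q x) :
    ∃ (a : F) (e : E), e ≠ 0 ∧ s e = a • e ∧ Q e = 0 := by
  obtain ⟨a, ha⟩ := Module.End.exists_eigenvalue s
  obtain ⟨e, he⟩ := ha.exists_hasEigenvector
  have hse := he.apply_eq_smul
  by_cases hQe : Q e = 0
  · exact ⟨a, e, he.2, hse, hQe⟩
  have hpol : Q.polarBilin = B := hQB.resolve_left fun h => hQe (by simp [h])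
  obtain ⟨μ, f, hsf, hef⟩ := exists_eigenvector_pairing hs hnd he.2
  have ha1 : a = 1 := by
    have h := hsQ e
    rw [hse, QuadraticMap.map_smul, smul_eq_mul] at h
    have h1 : (a - 1) * (a - 1) = 0 := by
      linear_combination (mul_right_cancel₀ hQe (h.trans (one_mul _).symm)) +
        (1 - a) * (CharTwo.two_eq_zero (R := F))
    exact sub_eq_zero.1 (mul_self_eq_zero.1 h1)
  have hμ1 : μ = 1 := by
    have h := hsB e f
    rwa [hse, hsf, ha1, one_smul, map_smul, hef, smul_eq_mul, mul_one] at h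
  rw [ha1, one_smul] at hse
  rw [hμ1, one_smul] at hsf
  -- a root of `Q(α e + f) = Q(e) α² + α + Q(f)`
  obtain ⟨α, hα⟩ : ∃ α : F, Q e * α ^ 2 + α + Q f = 0 := by
    have hdeg : (Polynomial.C (Q e) * Polynomial.X ^ 2 + Polynomial.C 1 * Polynomial.X +
      Polynomial.C (Q f)).degree ≠ 0 := by
      rw [Polynomial.degree_quadratic hQe]; decide
    obtain ⟨α, hα⟩ := IsAlgClosed.exists_root _ hdeg
    exact ⟨α, by simpa [Polynomial.IsRoot] using hα⟩
  refine ⟨1, α • e + f, fun h0 => ?_, by simp [hse, hsf], ?_⟩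
  · have h := congrArg (B e) h0
    rw [map_add, map_smul, hB, smul_zero, zero_add, hef, map_zero] at h
    exact one_ne_zero h
  · rw [map_add_of_polar hpol, QuadraticMap.map_smul, map_smul, LinearMap.smul_apply, hef,
      smul_eq_mul, smul_eq_mul, mul_one]
    linear_combination hα

/-- A semisimple isometry preserves a hyperbolic pair of eigenlines. -/
theorem exists_hyperbolic_eigenpair [Nontrivial E] (hs : s.IsSemisimple) (hB : B.IsAlt)
    (hnd : ∀ x, (∀ y, B x y = 0) → x = 0) (hsB : ∀ x y, B (s x) (s y) = B x y)
    (hQB : Q = 0 ∨ Q.polarBilin = B) (hsQ : ∀ x, Q (s x) = Q x) :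
    ∃ (a : Fˣ) (e f : E), s e = (a : F) • e ∧ s f = ((a⁻¹ : Fˣ) : F) • f ∧ Q e = 0 ∧ Q f = 0 ∧
      B e f = 1 := by
  obtain ⟨a, e, he0, hse, hQe⟩ := exists_isotropic_eigenvector hs hB hnd hsB hQB hsQ
  obtain ⟨μ, f, hsf, hef⟩ := exists_eigenvector_pairing hs hnd he0
  have haμ : a * μ = 1 := by
    have h := hsB e f
    rwa [hse, hsf, map_smul, map_smul, LinearMap.smul_apply, hef, smul_eq_mul, smul_eq_mul, mul_one,
      mul_comm] at h
  have hμa : μ * a = 1 := mul_comm a μ ▸ haμ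
  let u : Fˣ := ⟨a, μ, haμ, hμa⟩
  by_cases hQf : Q f = 0
  · exact ⟨u, e, f, hse, hsf, hQe, hQf, hef⟩
  have hpol : Q.polarBilin = B := hQB.resolve_left fun h => hQf (by simp [h])
  have hμ1 : μ = 1 := by
    have h := hsQ f
    rw [hsf, QuadraticMap.map_smul, smul_eq_mul] at h
    have h1 : (μ - 1) * (μ - 1) = 0 := by
      linear_combination (mul_right_cancel₀ hQf (h.trans (one_mul _).symm)) +
        (1 - μ) * (CharTwo.two_eq_zero (R := F))
    exact sub_eq_zero.1 (mul_self_eq_zero.1 h1)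
  have ha1 : a = 1 := by rwa [hμ1, mul_one] at haμ
  refine ⟨1, e, f + Q f • e, by simp [hse, ha1], by simp [hse, hsf, ha1, hμ1], hQe, ?_, ?_⟩
  · rw [map_add_of_polar hpol, QuadraticMap.map_smul, hQe, map_smul, isAlt_symm hB, hef]
    linear_combination Q f * (CharTwo.two_eq_zero (R := F))
  · rw [map_add, map_smul, hB, hef, smul_zero, add_zero]

end Hyperbolic

/-- A semisimple isometry of a nondegenerate space of dimension `2n`, symplectic (`Q = 0`) or
quadratic, has a hyperbolic basis of eigenvectors: split off one pair and pass to its orthogonal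
complement. -/
theorem exists_isHyperbolicEigenbasis {F : Type*} [Field F] [IsAlgClosed F] [CharP F 2] (n : ℕ) :
    ∀ {E : Type*} [AddCommGroup E] [Module F E] [FiniteDimensional F E]
      {B : LinearMap.BilinForm F E} {Q : QuadraticForm F E} {s : End F E},
      finrank F E = 2 * n → s.IsSemisimple → B.IsAlt → (∀ x, (∀ y, B x y = 0) → x = 0) →
      (∀ x y, B (s x) (s y) = B x y) → (Q = 0 ∨ Q.polarBilin = B) → (∀ x, Q (s x) = Q x) →
      ∃ (e f : Fin n → E) (a : Fin n → Fˣ), IsHyperbolicEigenbasis B Q s e f a := by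
  induction n with
  | zero =>
    intro E _ _ _ B Q s hdim _ _ _ _ _ _
    have := finrank_zero_iff.1 (hdim.trans (mul_zero 2))
    exact ⟨Fin.elim0, Fin.elim0, Fin.elim0,
      { map_left := fun i => i.elim0, map_right := fun i => i.elim0
        left_left := fun i => i.elim0, right_right := fun i => i.elim0
        left_right_self := fun i => i.elim0, left_right_of_ne := fun i => i.elim0
        apply_left := fun i => i.elim0, apply_right := fun i => i.elim0
        eq_zero := fun x _ _ => Subsingleton.elim x 0 }⟩
  | succ n ih =>
    intro E _ _ _ B Q s hdim hs hB hnd hsB hQB hsQ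
    have : Nontrivial E := Module.nontrivial_of_finrank_pos (R := F) (by omega)
    obtain ⟨a, e, f, hse, hsf, hQe, hQf, hef⟩ := exists_hyperbolic_eigenpair hs hB hnd hsB hQB hsQ
    have hfe : B f e = 1 := by rw [isAlt_symm hB, hef]
    let W : Submodule F E := LinearMap.ker ((B e).prod (B f))
    have hW : ∀ x, x ∈ W ↔ B e x = 0 ∧ B f x = 0 := fun x => by simp [W]
    have hsurj : Function.Surjective ((B e).prod (B f)) := by
      rintro ⟨x, y⟩
      refine ⟨x • f + y • e, ?_⟩
      simp [hef, hfe, hB e, hB f]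
    have hWdim : finrank F W = 2 * n := by
      have h := LinearMap.finrank_range_add_finrank_ker ((B e).prod (B f))
      rw [LinearMap.range_eq_top.2 hsurj, finrank_top, finrank_prod, finrank_self, hdim] at h
      change 1 + 1 + finrank F W = _ at h
      omega
    have hsW : ∀ x ∈ W, s x ∈ W := by
      intro x hx
      rw [hW] at hx ⊢
      have h1 := hsB e x
      have h2 := hsB f x
      rw [hse, hx.1, map_smul, LinearMap.smul_apply, smul_eq_mul] at h1
      rw [hsf, hx.2, map_smul, LinearMap.smul_apply, smul_eq_mul] at h2
      exact ⟨(mul_eq_zero.1 h1).resolve_left (Units.ne_zero _),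
        (mul_eq_zero.1 h2).resolve_left (Units.ne_zero _)⟩
    have hWx : ∀ x, x - B x f • e - B x e • f ∈ W := by
      intro x
      rw [hW]
      simp [hef, hfe, hB e, hB f, isAlt_symm hB x]
    obtain ⟨e', f', a', h⟩ := ih (B := B.restrict W) (Q := Q.comp W.subtype) (s := s.restrict hsW)
      hWdim (hs.restrict (p := W) hsW) (fun x => hB x)
      (fun x hx => by
        refine Subtype.ext (hnd x fun y => ?_)
        have h1 := hx ⟨_, hWx y⟩
        have h2 := (hW x).1 x.2
        simpa [isAlt_symm hB x, h2.1, h2.2, isAlt_symm hB e, isAlt_symm hB f] using h1)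
      (fun x y => hsB x y)
      (hQB.imp (fun h => by ext x; simp [h])
        (fun h => by
          ext x y
          simp [← h, QuadraticMap.polar]))
      (fun x => hsQ x)
    have heW : ∀ x : W, B e x = 0 := fun x => ((hW x).1 x.2).1
    have hfW : ∀ x : W, B f x = 0 := fun x => ((hW x).1 x.2).2
    have hWe : ∀ x : W, B x e = 0 := fun x => by rw [isAlt_symm hB, heW]
    have hWf : ∀ x : W, B x f = 0 := fun x => by rw [isAlt_symm hB, hfW]
    refine ⟨Fin.cons e fun i => e' i, Fin.cons f fun i => f' i, Fin.cons a a', ?_⟩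
    exact
    { map_left := Fin.cases hQe h.map_left
      map_right := Fin.cases hQf h.map_right
      left_left := Fin.cases (Fin.cases (hB e) fun j => heW _)
        fun i => Fin.cases (hWe _) (h.left_left i)
      right_right := Fin.cases (Fin.cases (hB f) fun j => hfW _)
        fun i => Fin.cases (hWf _) (h.right_right i)
      left_right_self := Fin.cases hef h.left_right_self
      left_right_of_ne := Fin.cases (Fin.cases (fun h => absurd rfl h) fun j _ => heW _)
        fun i => Fin.cases (fun _ => hWf _)
          fun j hij => h.left_right_of_ne i j fun hc => hij (congrArg Fin.succ hc)
      apply_left := Fin.cases hse fun i => congrArg Subtype.val (h.apply_left i)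
      apply_right := Fin.cases hsf fun i => congrArg Subtype.val (h.apply_right i)
      eq_zero := fun x h₁ h₂ => by
        have hx : x ∈ W := (hW x).2 ⟨by rw [isAlt_symm hB]; exact h₁ 0,
          by rw [isAlt_symm hB]; exact h₂ 0⟩
        exact congrArg Subtype.val (h.eq_zero ⟨x, hx⟩ (fun i => h₁ i.succ) fun i => h₂ i.succ) }

/-! ### The Frobenius map and the weights in types C and D -/

section Frobenius

variable {F : Type*} [Field F] [CharP F 2] {E : Type*} [AddCommGroup E] [Module F E]
  {B : LinearMap.BilinForm F E} {Q : QuadraticForm F E} {s : End F E} {n : ℕ}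

/-- If the `q`-th power of every eigenvalue is an eigenvalue, a hyperbolic basis of eigenvectors can
be ordered so that the `q`-th power of the first eigenvalue is that eigenvalue or its inverse, or
is inverse to the second eigenvalue. -/
theorem IsHyperbolicEigenbasis.exists_frobenius_ordered (hn : 1 < n) (hB : B.IsAlt)
    {e f : Fin n → E} {a : Fin n → Fˣ} (h : IsHyperbolicEigenbasis B Q s e f a)
    (hsB : ∀ x y, B (s x) (s y) = B x y) {q : ℕ}
    (hq : ∀ (c : F) (x : E), x ≠ 0 → s x = c • x → ∃ y : E, y ≠ 0 ∧ s y = c ^ q • y) :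
    ∃ (e f : Fin n → E) (a : Fin n → Fˣ), IsHyperbolicEigenbasis B Q s e f a ∧
      (a ⟨0, by omega⟩ ^ q = a ⟨0, by omega⟩ ∨ a ⟨0, by omega⟩ ^ q * a ⟨0, by omega⟩ = 1 ∨
        a ⟨0, by omega⟩ ^ q * a ⟨1, hn⟩ = 1) := by
  set i₀ : Fin n := ⟨0, by omega⟩ with hi₀
  set i₁ : Fin n := ⟨1, hn⟩ with hi₁
  have h01 : i₀ ≠ i₁ := by simp [hi₀, hi₁]
  have he0 : e i₀ ≠ 0 := by
    intro h0
    have := h.left_right_self i₀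
    simp [h0] at this
  obtain ⟨y, hy0, hy⟩ := hq _ _ he0 (h.apply_left i₀)
  -- pair an eigenvector for `a₀ ^ q` with the hyperbolic basis
  have hj : ∃ j, a i₀ ^ q * a j = 1 ∨ a i₀ ^ q = a j := by
    by_contra! hc
    refine hy0 (h.eq_zero y (fun i => ?_) (fun i => ?_))
    · by_contra hne
      have h1 := hsB y (e i)
      rw [hy, h.apply_left, map_smul, map_smul, LinearMap.smul_apply, smul_smul,
        smul_eq_mul] at h1
      refine (hc i).1 (Units.ext ?_)
      push_cast
      rw [mul_comm]
      exact mul_right_cancel₀ hne (h1.trans (one_mul _).symm)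
    · by_contra hne
      have h1 := hsB y (f i)
      rw [hy, h.apply_right, map_smul, map_smul, LinearMap.smul_apply, smul_smul,
        smul_eq_mul] at h1
      have h2 : (((a i)⁻¹ : Fˣ) : F) * (a i₀ : F) ^ q = 1 :=
        mul_right_cancel₀ hne (h1.trans (one_mul _).symm)
      refine (hc i).2 ?_
      rw [← inv_mul_eq_one.1 (Units.ext (by push_cast; simpa using h2) : (a i)⁻¹ * a i₀ ^ q = 1)]
  obtain ⟨j, hj⟩ := hj
  by_cases hj0 : j = i₀
  · subst hj0
    exact ⟨e, f, a, h, hj.elim (fun h => Or.inr (Or.inl h)) Or.inl⟩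
  -- otherwise the pair `j` is moved to the second place, and flipped if necessary
  have hsw0 : Equiv.swap i₁ j i₀ = i₀ := Equiv.swap_apply_of_ne_of_ne h01 (Ne.symm hj0)
  have h' := h.comp_equiv (Equiv.swap i₁ j)
  rcases hj with hj | hj
  · exact ⟨_, _, _, h', Or.inr (Or.inr (by simpa [hsw0] using hj))⟩
  · refine ⟨_, _, _, h'.flip hB i₁, Or.inr (Or.inr ?_)⟩
    rw [Function.update_of_ne h01, Function.update_self]
    simp [hsw0, hj]

end Frobenius

/-- The weights of types `C_n` and `D_n` that matter: if the values `a₀`, `a₁` of `ε_1`, `ε_2` at a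
torus element satisfy one of three relations, then one of the weights is trivial on it. -/
theorem hasEigenvalue_one_of_frobenius_relation {F V G : Type*} [Field F] [AddCommGroup V]
    [Module F V] [Group G] {T : Subgroup G} {ρ : Representation F G V} {n q : ℕ} (hn : 1 < n)
    (hq : 1 ≤ q) {ε : Fin n → CharGroup F T} {m₁ m₂ m₃ : ℕ}
    (hw₁ : IsWeight T ρ (m₁ • (q + 1) • partialSum ε 1))
    (hw₂ : IsWeight T ρ (m₂ • (q - 1) • partialSum ε 1))
    (hw₃ : IsWeight T ρ (m₃ • ((q - 1) • partialSum ε 1 + partialSum ε 2)))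
    {g h : G} (t : T) (hg : g * h = h * t) {a₀ a₁ : Fˣ} (h₀ : (ε ⟨0, by omega⟩).toMul t = a₀)
    (h₁ : (ε ⟨1, hn⟩).toMul t = a₁) (ha : a₀ ^ q = a₀ ∨ a₀ ^ q * a₀ = 1 ∨ a₀ ^ q * a₁ = 1) :
    Module.End.HasEigenvalue (ρ g) 1 := by
  have hq1 : q - 1 + 1 = q := Nat.sub_add_cancel hq
  have e1 : (partialSum ε 1).toMul t = a₀ := by
    rw [toMul_partialSum]
    have : (Finset.univ.filter fun j : Fin n => (j : ℕ) < 1) = {⟨0, by omega⟩} := by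
      ext j; simp [Fin.ext_iff]
    rw [this, Finset.prod_singleton, h₀]
  have e2 : (partialSum ε 2).toMul t = a₀ * a₁ := by
    rw [toMul_partialSum]
    have : (Finset.univ.filter fun j : Fin n => (j : ℕ) < 2) = {⟨0, by omega⟩, ⟨1, hn⟩} := by
      ext j; simp [Fin.ext_iff]; omega
    rw [this, Finset.prod_pair (by simp), h₀, h₁]
  rcases ha with ha | ha | ha
  · refine hasEigenvalue_one_of_weight hw₂ t hg ?_
    rw [toMul_nsmul_apply, toMul_nsmul_apply, e1]
    rw [← hq1, pow_succ] at ha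
    rw [mul_eq_right.1 ha, one_pow]
  · refine hasEigenvalue_one_of_weight hw₁ t hg ?_
    rw [toMul_nsmul_apply, toMul_nsmul_apply, e1, pow_succ, ha, one_pow]
  · refine hasEigenvalue_one_of_weight hw₃ t hg ?_
    rw [toMul_nsmul_apply, toMul_add_apply, toMul_nsmul_apply, e1, e2, ← mul_assoc, ← pow_succ, hq1,
      ha, one_pow]

/-! ### Symplectic groups -/

section TypeC

variable {F : Type*} [Field F] [IsAlgClosed F] [CharP F 2] {n : ℕ}

theorem hasEigenvalue_one_typeC {V : Type*} [AddCommGroup V] [Module F V] (hn : 1 < n)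
    {q k : ℕ} (hq : q = 2 ^ k) (ρ : Representation F (groupC F n) V) {m₁ m₂ m₃ : ℕ}
    (hw₁ : IsWeight (torusC F n) ρ (m₁ • (q + 1) • omegaC F n 1))
    (hw₂ : IsWeight (torusC F n) ρ (m₂ • (q - 1) • omegaC F n 1))
    (hw₃ : IsWeight (torusC F n) ρ (m₃ • ((q - 1) • omegaC F n 1 + omegaC F n 2)))
    {g : groupC F n} (hg : g ∈ finiteC F n q) (hs : IsSemisimpleElement F g.1) :
    Module.End.HasEigenvalue (ρ g) 1 := by
  let φ := iterateFrobenius F 2 k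
  have hφ : ∀ x, φ x = x ^ q := fun x => by simp [φ, iterateFrobenius_def, hq]
  set M : Matrix (Fin n ⊕ Fin n) (Fin n ⊕ Fin n) F :=
    ((g : (Matrix (Fin n ⊕ Fin n) (Fin n ⊕ Fin n) F)ˣ) :
      Matrix (Fin n ⊕ Fin n) (Fin n ⊕ Fin n) F)
  let s := Matrix.toLin' M
  let B := Matrix.toBilin' (Matrix.J (Fin n) F)
  have hBdef : ∀ x y, B x y = x ⬝ᵥ (Matrix.J (Fin n) F).mulVec y := fun x y =>
    Matrix.toBilin'_apply' _ _ _
  have hBe : ∀ x y, B x y =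
      ∑ i, (x (Sum.inl i) * y (Sum.inr i) + x (Sum.inr i) * y (Sum.inl i)) := by
    intro x y
    have h1 : (-1 : Matrix (Fin n) (Fin n) F) = 1 := by
      ext i j
      rw [Matrix.neg_apply, CharTwo.neg_eq]
    rw [hBdef, Matrix.J, h1]
    simp [Matrix.fromBlocks_mulVec, dotProduct, Finset.sum_add_distrib, Function.comp_def]
  have hB : B.IsAlt := fun x => by
    rw [hBe]
    exact Finset.sum_eq_zero fun i _ => by rw [mul_comm, CharTwo.add_self_eq_zero]
  have hMJ : M.transpose * Matrix.J (Fin n) F * M = Matrix.J (Fin n) F :=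
    SymplecticGroup.mem_iff'.1 g.2.1
  have hsB : ∀ x y, B (s x) (s y) = B x y := by
    intro x y
    rw [hBdef, hBdef, Matrix.toLin'_apply, Matrix.toLin'_apply]
    conv_rhs => rw [← hMJ, ← Matrix.mulVec_mulVec, ← Matrix.mulVec_mulVec,
      Matrix.dotProduct_mulVec x, Matrix.vecMul_transpose]
  have hnd : ∀ x, (∀ y, B x y = 0) → x = 0 := by
    intro x hx
    ext i
    rcases i with i | i
    · simpa [hBe, Pi.single_apply] using hx (Pi.single (Sum.inr i) 1)
    · simpa [hBe, Pi.single_apply] using hx (Pi.single (Sum.inl i) 1)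
  have hss : Module.End.IsSemisimple s := isSemisimple_toLin' hs
  obtain ⟨e, f, a, h⟩ := exists_isHyperbolicEigenbasis n (Q := 0)
    (by simp [two_mul]) hss hB hnd hsB (Or.inl rfl) (fun _ => rfl)
  obtain ⟨e, f, a, h, ha⟩ := h.exists_frobenius_ordered hn hB hsB (q := q) (by
    intro c x hx hsx
    refine ⟨φ ∘ x, fun h0 => hx ?_, ?_⟩
    · ext i
      exact (map_eq_zero φ).1 (congrFun h0 i)
    · have h1 : M.map φ = M := by ext i j; rw [Matrix.map_apply, hφ]; exact hg i j
      have h2 : φ ∘ (M.mulVec x) = (M.map φ).mulVec (φ ∘ x) := by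
        ext i; simp [Matrix.mulVec, dotProduct]
      rw [h1] at h2
      rw [Matrix.toLin'_apply] at hsx ⊢
      rw [← h2, hsx]
      ext i
      simp [hφ, mul_pow])
  -- the matrix whose columns are the symplectic basis
  let P : Matrix (Fin n ⊕ Fin n) (Fin n ⊕ Fin n) F := fun i j => Sum.elim e f j i
  have hPB : ∀ i j, (P.transpose * Matrix.J (Fin n) F * P) i j =
      B (Sum.elim e f i) (Sum.elim e f j) := by
    intro i j
    rw [hBdef, Matrix.mul_assoc, Matrix.mul_apply]
    rfl
  have hP : P ∈ Matrix.symplecticGroup (Fin n) F := by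
    rw [SymplecticGroup.mem_iff']
    ext i j
    rw [hPB]
    rcases i with i | i <;> rcases j with j | j
    · simp [h.left_left, Matrix.J]
    · by_cases hij : i = j
      · subst hij; simp [h.left_right_self, Matrix.J, CharTwo.neg_eq]
      · simp [h.left_right_of_ne i j hij, Matrix.J, hij]
    · by_cases hij : i = j
      · subst hij; simp [isAlt_symm hB (f i), h.left_right_self, Matrix.J]
      · simp [isAlt_symm hB (f i), h.left_right_of_ne j i (Ne.symm hij), Matrix.J, hij]
    · simp [h.right_right, Matrix.J]
  let P' := Units.map (Matrix.symplecticGroup (Fin n) F).subtype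
    (toUnits (⟨P, hP⟩ : Matrix.symplecticGroup (Fin n) F))
  have hP'mem : P' ∈ groupC F n := ⟨hP, ((toUnits
    (⟨P, hP⟩ : Matrix.symplecticGroup (Fin n) F))⁻¹ : (Matrix.symplecticGroup (Fin n) F)ˣ).val.2⟩
  obtain ⟨t, hgt, ht⟩ := exists_diagTorus_of_mul_eq (g := g) (P := ⟨P', hP'mem⟩)
    (d := Sum.elim (fun i => (a i : F)) (fun i => ((a i)⁻¹ : Fˣ))) (by
      change M * P = P * _
      ext i j
      rw [Matrix.mul_diagonal, Matrix.mul_apply]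
      rcases j with j | j
      · have h1 := congrFun (h.apply_left j) i
        simpa [P, s, Matrix.mulVec, dotProduct, mul_comm] using h1
      · have h1 := congrFun (h.apply_right j) i
        simpa [P, s, Matrix.mulVec, dotProduct, mul_comm] using h1)
  exact hasEigenvalue_one_of_frobenius_relation hn (hq ▸ Nat.one_le_two_pow) hw₁ hw₂ hw₃ t hgt
    (Units.ext (ht _)) (Units.ext (ht _)) ha

end TypeC

/-! ### Products of reflections -/

section Reflections

variable {F : Type*} [Field F] {E : Type*} [AddCommGroup E] [Module F E] (Q : QuadraticForm F E)

/-- The orthogonal reflection `x ↦ x - B(w, x) Q(w)⁻¹ w` in an anisotropic vector `w`, where `B` is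
the polar form of `Q`; the identity if `Q(w) = 0`. -/
def reflection (w : E) : End F E :=
  LinearMap.id - ((Q w)⁻¹ • Q.polarBilin w).smulRight w

theorem reflection_apply (w x : E) :
    reflection Q w x = x - ((Q w)⁻¹ * Q.polarBilin w x) • w := rfl

/-- The monoid of products of reflections in vectors of norm `1`. -/
def reflectionMonoid : Submonoid (End F E) :=
  Submonoid.closure {r | ∃ w, Q w = 1 ∧ r = reflection Q w}

theorem isAlt_polarBilin [CharP F 2] : (Q.polarBilin).IsAlt := fun x => by
  rw [QuadraticMap.polarBilin_apply_apply, QuadraticMap.polar_self, two_smul,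
    CharTwo.add_self_eq_zero]

variable {Q}

theorem polarBilin_comm (x y : E) : Q.polarBilin x y = Q.polarBilin y x :=
  QuadraticMap.polar_comm _ _ _

theorem polarBilin_self (x : E) : Q.polarBilin x x = 2 * Q x := by
  rw [QuadraticMap.polarBilin_apply_apply, QuadraticMap.polar_self, two_smul, two_mul]

theorem polarBilin_reflection_self {w : E} (hw : Q w ≠ 0) (x : E) :
    Q.polarBilin w (reflection Q w x) = - Q.polarBilin w x := by
  rw [reflection_apply, map_sub, map_smul, polarBilin_self, smul_eq_mul]
  field_simp
  ring

theorem reflection_reflection {w : E} (hw : Q w ≠ 0) (x : E) :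
    reflection Q w (reflection Q w x) = x := by
  rw [reflection_apply Q w (reflection Q w x), polarBilin_reflection_self hw, reflection_apply,
    mul_neg, neg_smul, sub_neg_eq_add, sub_add_cancel]

theorem map_reflection {w : E} (hw : Q w ≠ 0) (x : E) : Q (reflection Q w x) = Q x := by
  rw [reflection_apply, sub_eq_add_neg, ← neg_smul, map_add_of_polar rfl, QuadraticMap.map_smul,
    map_smul, polarBilin_comm x w, smul_eq_mul, smul_eq_mul]
  field_simp
  ring

theorem map_apply_of_mem_reflectionMonoid {r : End F E} (hr : r ∈ reflectionMonoid Q) (x : E) :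
    Q (r x) = Q x := by
  induction hr using Submonoid.closure_induction generalizing x with
  | mem r hr =>
    obtain ⟨w, hw, rfl⟩ := hr
    exact map_reflection (by rw [hw]; exact one_ne_zero) x
  | one => rfl
  | mul r s _ _ hr hs => rw [End.mul_apply, hr, hs]

theorem polarBilin_map_of_map {s : End F E} (hs : ∀ x, Q (s x) = Q x) (x y : E) :
    Q.polarBilin (s x) (s y) = Q.polarBilin x y := by
  rw [QuadraticMap.polarBilin_apply_apply, QuadraticMap.polarBilin_apply_apply, QuadraticMap.polar,
    QuadraticMap.polar, ← map_add, hs, hs, hs]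

theorem polarBilin_apply_of_mem_reflectionMonoid {r : End F E} (hr : r ∈ reflectionMonoid Q)
    (x y : E) : Q.polarBilin (r x) (r y) = Q.polarBilin x y :=
  polarBilin_map_of_map (map_apply_of_mem_reflectionMonoid hr) x y

variable [IsAlgClosed F]

theorem reflection_mem_reflectionMonoid {w : E} (hw : Q w ≠ 0) :
    reflection Q w ∈ reflectionMonoid Q := by
  obtain ⟨c, hc⟩ := IsAlgClosed.exists_pow_nat_eq (Q w)⁻¹ (n := 2) (by norm_num)
  have hc0 : c ≠ 0 := by
    rintro rfl
    exact inv_ne_zero hw (by rw [← hc]; norm_num)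
  have hQ : Q (c • w) = 1 := by
    rw [QuadraticMap.map_smul, smul_eq_mul, ← pow_two, hc, inv_mul_cancel₀ hw]
  refine Submonoid.subset_closure ⟨c • w, hQ, ?_⟩
  ext x
  rw [reflection_apply, reflection_apply, hQ, map_smul, LinearMap.smul_apply, smul_smul, ← hc]
  congr 2
  simp only [inv_one, smul_eq_mul]
  ring

variable [CharP F 2]

/-- In characteristic `2`, where `Q(x - y) = B(x, y)` for vectors of equal norm, the reflection in `x - y` moves `x` to `y`. -/
theorem exists_move {x y : E} (hxy : Q x = Q y) (h : Q.polarBilin x y ≠ 0) :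
    ∃ r ∈ reflectionMonoid Q, r x = y ∧
      ∀ z, Q.polarBilin z x = Q.polarBilin z y → r z = z := by
  have h2 : (2 : F) = 0 := CharTwo.two_eq_zero
  have hQ : Q (x - y) = Q.polarBilin x y := by
    rw [sub_eq_add_neg, map_add_of_polar rfl, QuadraticMap.map_neg, map_neg, hxy]
    linear_combination (Q y - Q.polarBilin x y) * h2
  refine ⟨reflection Q (x - y), reflection_mem_reflectionMonoid (by rwa [hQ]), ?_, fun z hz => ?_⟩
  · have h1 : Q.polarBilin (x - y) x = Q.polarBilin x y := by
      rw [map_sub, LinearMap.sub_apply, polarBilin_self, polarBilin_comm y x]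
      linear_combination (Q x - Q.polarBilin x y) * h2
    rw [reflection_apply, hQ, h1, inv_mul_cancel₀ h, one_smul, sub_sub_cancel]
  · rw [reflection_apply, polarBilin_comm, map_sub (Q.polarBilin z), hz, sub_self, mul_zero,
      zero_smul, sub_zero]

/-- A move from `x` to `y` in two steps, for the case that `x` and `y` are orthogonal. -/
theorem exists_move_via {x y : E} (w : E) (hxw : Q x = Q w) (hwy : Q w = Q y)
    (h₁ : Q.polarBilin x w ≠ 0) (h₂ : Q.polarBilin w y ≠ 0) :
    ∃ r ∈ reflectionMonoid Q, r x = y ∧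
      ∀ z, Q.polarBilin z x = Q.polarBilin z w → Q.polarBilin z w = Q.polarBilin z y →
        r z = z := by
  obtain ⟨r, hr, hrx, hrz⟩ := exists_move hxw h₁
  obtain ⟨s, hs, hsx, hsz⟩ := exists_move hwy h₂
  refine ⟨s * r, mul_mem hs hr, by rw [End.mul_apply, hrx, hsx], fun z h h' => ?_⟩
  rw [End.mul_apply, hrz z h, hsz z h']

/-- The first vector of a hyperbolic pair can be moved to that of another hyperbolic pair by
reflections fixing everything orthogonal to both pairs. -/
theorem exists_move_left {u v u' v' : E} (hu : Q u = 0) (hv : Q v = 0) (hu' : Q u' = 0)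
    (hv' : Q v' = 0) (huv : Q.polarBilin u v = 1) (huv' : Q.polarBilin u' v' = 1) :
    ∃ r ∈ reflectionMonoid Q, r u = u' ∧
      ∀ z, Q.polarBilin z u = 0 → Q.polarBilin z v = 0 → Q.polarBilin z u' = 0 →
        Q.polarBilin z v' = 0 → r z = z := by
  by_cases h1 : Q.polarBilin u u' = 0
  swap
  · obtain ⟨r, hr, hru, hrz⟩ := exists_move (hu.trans hu'.symm) h1
    exact ⟨r, hr, hru, fun z h _ h' _ => hrz z (by rw [h, h'])⟩
  by_cases h2 : Q.polarBilin v u' = 0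
  swap
  · obtain ⟨r, hr, hru, hrz⟩ := exists_move_via v (hu.trans hv.symm) (hv.trans hu'.symm)
      (by rw [huv]; exact one_ne_zero) h2
    exact ⟨r, hr, hru, fun z h h' h'' _ => hrz z (by rw [h, h']) (by rw [h', h''])⟩
  by_cases h3 : Q.polarBilin u v' = 0
  swap
  · obtain ⟨r, hr, hru, hrz⟩ := exists_move_via v' (hu.trans hv'.symm) (hv'.trans hu'.symm)
      h3 (by rw [polarBilin_comm, huv']; exact one_ne_zero)
    exact ⟨r, hr, hru, fun z h _ h' h'' => hrz z (by rw [h, h'']) (by rw [h', h''])⟩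
  -- now the two pairs are orthogonal up to `B(v, v')`, which is corrected by a multiple of `u`
  have hvu : Q.polarBilin v u = 1 := by rw [polarBilin_comm, huv]
  have hv'u : Q.polarBilin v' u = 0 := by rw [polarBilin_comm, h3]
  have hv'u' : Q.polarBilin v' u' = 1 := by rw [polarBilin_comm, huv']
  set c := Q.polarBilin v v' with hc
  have hw : Q (v + v' + c • u) = 0 := by
    rw [map_add_of_polar rfl, map_add_of_polar rfl, QuadraticMap.map_smul, hu, hv, hv', ← hc,
      map_smul, map_add, LinearMap.add_apply, hvu, hv'u]
    simp [CharTwo.add_self_eq_zero]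
  obtain ⟨r, hr, hru, hrz⟩ := exists_move_via (v + v' + c • u) (hu.trans hw.symm)
    (hw.trans hu'.symm)
    (by simp only [map_add, map_smul, huv, h3, polarBilin_self, hu]; simp)
    (by
      simp only [map_add, map_smul, LinearMap.add_apply, LinearMap.smul_apply, h1, h2, hv'u']
      simp)
  exact ⟨r, hr, hru, fun z h h' h'' h₃ => hrz z
    (by simp only [map_add, map_smul, h, h', h₃, smul_zero, add_zero])
    (by simp only [map_add, map_smul, h, h', h'', h₃, smul_zero, add_zero])⟩

/-- The second vector `v` of a hyperbolic pair `(u, v)` can be moved to that of `(u, v')` by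
reflections fixing `u`, if some isotropic vector `p` is orthogonal to `u` and `v'`, but not to
`v`. -/
theorem exists_move_right_of_polar_eq_zero {u v v' p : E} (hu : Q u = 0) (hv : Q v = 0)
    (hv' : Q v' = 0) (hp : Q p = 0) (huv : Q.polarBilin u v = 1) (huv' : Q.polarBilin u v' = 1)
    (hvv' : Q.polarBilin v v' = 0) (hup : Q.polarBilin u p = 0) (hv'p : Q.polarBilin v' p = 0)
    (hvp : Q.polarBilin v p ≠ 0) :
    ∃ r ∈ reflectionMonoid Q, r u = u ∧ r v = v' ∧
      ∀ z, Q.polarBilin z u = 0 → Q.polarBilin z v = 0 → Q.polarBilin z v' = 0 →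
        Q.polarBilin z p = 0 → r z = z := by
  classical
  have h2 : (2 : F) = 0 := CharTwo.two_eq_zero
  have : Infinite F := IsAlgClosed.instInfinite
  obtain ⟨α, hα⟩ := Infinite.exists_notMem_finset ({0, 1} : Finset F)
  simp only [Finset.mem_insert, Finset.mem_singleton, not_or] at hα
  have hvu : Q.polarBilin v u = 1 := by rw [polarBilin_comm, huv]
  have hv'u : Q.polarBilin v' u = 1 := by rw [polarBilin_comm, huv']
  have hpu : Q.polarBilin p u = 0 := by rw [polarBilin_comm, hup]
  have hpv' : Q.polarBilin p v' = 0 := by rw [polarBilin_comm, hv'p]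
  have hv'v : Q.polarBilin v' v = 0 := by rw [polarBilin_comm, hvv']
  set c := Q.polarBilin v p with hc
  -- an isotropic vector pairing to `1` with `u` and nontrivially with `v` and `v'`
  have hw : Q (α • v + (1 + α) • v' + c⁻¹ • p + α • u) = 0 := by
    simp only [map_add_of_polar (Q := Q) rfl, QuadraticMap.map_smul, hu, hv, hv', hp, map_add,
      map_smul, LinearMap.add_apply, LinearMap.smul_apply, hvv', hvu, hv'u, hpu, hv'p, ← hc,
      smul_eq_mul]
    linear_combination (α + α ^ 2) * h2 + α * inv_mul_cancel₀ hvp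
  have huw : Q.polarBilin u (α • v + (1 + α) • v' + c⁻¹ • p + α • u) = 1 := by
    simp only [map_add, map_smul, huv, huv', hup, polarBilin_self, hu, smul_eq_mul]
    linear_combination α * h2
  obtain ⟨r, hr, hrv, hrz⟩ := exists_move_via (α • v + (1 + α) • v' + c⁻¹ • p + α • u)
    (hv.trans hw.symm) (hw.trans hv'.symm)
    (by
      simp only [map_add, map_smul, hvv', hvu, ← hc, polarBilin_self, hv, smul_eq_mul,
        inv_mul_cancel₀ hvp]
      intro h0
      exact hα.2 (by linear_combination h0 - h2))
    (by
      simp only [map_add, map_smul, LinearMap.add_apply, LinearMap.smul_apply, hvv', huv', hpv',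
        polarBilin_self, hv', smul_eq_mul]
      intro h0
      exact hα.1 (by linear_combination h0))
  refine ⟨r, hr, hrz u (by rw [huv, huw]) (by rw [huw, huv']), hrv,
    fun z h h' h'' h₃ => hrz z ?_ ?_⟩
  · simp only [map_add, map_smul, h, h', h'', h₃, smul_zero, add_zero]
  · simp only [map_add, map_smul, h, h', h'', h₃, smul_zero, add_zero]

/-- Witt's theorem for hyperbolic bases: any one is carried to any other by a product of
reflections. -/
theorem exists_reflectionMonoid_apply_eq {n : ℕ} {e f e' f' : Fin n → E}
    (h : IsHyperbolicBasis Q.polarBilin Q e f) (h' : IsHyperbolicBasis Q.polarBilin Q e' f') :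
    ∃ r ∈ reflectionMonoid Q, ∀ i, r (e i) = e' i ∧ r (f i) = f' i := by
  suffices H : ∀ k ≤ n, ∃ r ∈ reflectionMonoid Q,
      ∀ i : Fin n, (i : ℕ) < k → r (e i) = e' i ∧ r (f i) = f' i by
    obtain ⟨r, hr, hri⟩ := H n le_rfl
    exact ⟨r, hr, fun i => hri i i.2⟩
  intro k
  induction k with
  | zero => exact fun _ => ⟨1, one_mem _, fun i hi => absurd hi (Nat.not_lt_zero _)⟩
  | succ k ih =>
    intro hk
    obtain ⟨r, hr, hri⟩ := ih (by omega)
    set j : Fin n := ⟨k, hk⟩ with hj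
    have hQr := map_apply_of_mem_reflectionMonoid hr
    have hBr := polarBilin_apply_of_mem_reflectionMonoid hr
    have hne : ∀ i : Fin n, (i : ℕ) < k → i ≠ j := by
      rintro i hi rfl; exact lt_irrefl _ hi
    have hfe : ∀ i l, i ≠ l → Q.polarBilin (f i) (e l) = 0 := fun i l hil => by
      rw [polarBilin_comm, h.left_right_of_ne l i (Ne.symm hil)]
    have hfe' : ∀ i l, i ≠ l → Q.polarBilin (f' i) (e' l) = 0 := fun i l hil => by
      rw [polarBilin_comm, h'.left_right_of_ne l i (Ne.symm hil)]
    -- move `r e_k` to `e'_k`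
    obtain ⟨r₁, hr₁, hr₁u, hr₁z⟩ := exists_move_left (u := r (e j)) (v := r (f j)) (u' := e' j)
      (v' := f' j) (by rw [hQr, h.map_left]) (by rw [hQr, h.map_right]) (h'.map_left j)
      (h'.map_right j) (by rw [hBr, h.left_right_self]) (h'.left_right_self j)
    have hQr₁ := map_apply_of_mem_reflectionMonoid hr₁
    have hBr₁ := polarBilin_apply_of_mem_reflectionMonoid hr₁
    have hr₁e : ∀ i : Fin n, (i : ℕ) < k → r₁ (e' i) = e' i := fun i hi => hr₁z _
      (by rw [← (hri i hi).1, hBr, h.left_left])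
      (by rw [← (hri i hi).1, hBr, h.left_right_of_ne i j (hne i hi)])
      (h'.left_left _ _) (h'.left_right_of_ne i j (hne i hi))
    have hr₁f : ∀ i : Fin n, (i : ℕ) < k → r₁ (f' i) = f' i := fun i hi => hr₁z _
      (by rw [← (hri i hi).2, hBr, hfe i j (hne i hi)])
      (by rw [← (hri i hi).2, hBr, h.right_right])
      (hfe' i j (hne i hi)) (h'.right_right _ _)
    set v := r₁ (r (f j)) with hv
    have hQv : Q v = 0 := by rw [hv, hQr₁, hQr, h.map_right]
    have huv : Q.polarBilin (e' j) v = 1 := by rw [hv, ← hr₁u, hBr₁, hBr, h.left_right_self]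
    have hev : ∀ i : Fin n, (i : ℕ) < k → Q.polarBilin (e' i) v = 0 := fun i hi => by
      rw [← hr₁e i hi, hv, hBr₁, ← (hri i hi).1, hBr, h.left_right_of_ne i j (hne i hi)]
    have hfv : ∀ i : Fin n, (i : ℕ) < k → Q.polarBilin (f' i) v = 0 := fun i hi => by
      rw [← hr₁f i hi, hv, hBr₁, ← (hri i hi).2, hBr, h.right_right]
    -- move `v = r₁ r f_k` to `f'_k`
    obtain ⟨r₂, hr₂, hr₂u, hr₂v, hr₂z⟩ : ∃ r₂ ∈ reflectionMonoid Q, r₂ (e' j) = e' j ∧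
        r₂ v = f' j ∧ ∀ i : Fin n, (i : ℕ) < k → r₂ (e' i) = e' i ∧ r₂ (f' i) = f' i := by
      by_cases hvv : v = f' j
      · exact ⟨1, one_mem _, rfl, hvv, fun _ _ => ⟨rfl, rfl⟩⟩
      by_cases hB : Q.polarBilin v (f' j) = 0
      swap
      · obtain ⟨r₂, hr₂, hr₂v, hr₂z⟩ := exists_move (hQv.trans (h'.map_right j).symm) hB
        refine ⟨r₂, hr₂, hr₂z _ ?_, hr₂v, fun i hi => ⟨hr₂z _ ?_, hr₂z _ ?_⟩⟩
        · rw [huv, h'.left_right_self]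
        · rw [hev i hi, h'.left_right_of_ne i j (hne i hi)]
        · rw [hfv i hi, h'.right_right]
      -- the nonzero vector `v - f'_k` pairs nontrivially with a vector of a later pair
      have hB' : Q.polarBilin (f' j) v = 0 := by rw [polarBilin_comm, hB]
      have hu' : Q.polarBilin v (e' j) = 1 := by rw [polarBilin_comm, huv]
      obtain ⟨p, hQp, hup, hv'p, hvp, hpe⟩ : ∃ p, Q p = 0 ∧ Q.polarBilin (e' j) p = 0 ∧
          Q.polarBilin (f' j) p = 0 ∧ Q.polarBilin v p ≠ 0 ∧
          ∀ i : Fin n, (i : ℕ) < k → Q.polarBilin (e' i) p = 0 ∧ Q.polarBilin (f' i) p = 0 := by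
        by_contra! hc
        refine sub_ne_zero.2 hvv (h'.eq_zero _ (fun l => ?_) (fun l => ?_))
        · rw [map_sub, LinearMap.sub_apply]
          rcases lt_trichotomy (l : ℕ) k with hl | hl | hl
          · rw [polarBilin_comm, hev l hl, hfe' j l (hne l hl).symm, sub_zero]
          · have : l = j := Fin.ext hl
            rw [this, hu', polarBilin_comm (f' j), h'.left_right_self, sub_self]
          · have hlj : j ≠ l := by rintro rfl; exact lt_irrefl _ hl
            by_contra hne0
            rw [hfe' j l hlj, sub_zero] at hne0
            obtain ⟨i, hi, hi'⟩ := hc (e' l) (h'.map_left l) (h'.left_left _ _) (hfe' j l hlj) hne0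
            exact hi' (h'.left_left _ _) (hfe' i l (by rintro rfl; omega))
        · rw [map_sub, LinearMap.sub_apply, h'.right_right, sub_zero]
          rcases lt_trichotomy (l : ℕ) k with hl | hl | hl
          · rw [polarBilin_comm, hfv l hl]
          · have : l = j := Fin.ext hl
            rw [this, hB]
          · have hlj : j ≠ l := by rintro rfl; exact lt_irrefl _ hl
            by_contra hne0
            obtain ⟨i, hi, hi'⟩ := hc (f' l) (h'.map_right l) (h'.left_right_of_ne j l hlj)
              (h'.right_right _ _) hne0
            exact hi' (h'.left_right_of_ne i l (by rintro rfl; omega)) (h'.right_right _ _)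
      obtain ⟨r₂, hr₂, hr₂u, hr₂v, hr₂z⟩ := exists_move_right_of_polar_eq_zero (h'.map_left j) hQv
        (h'.map_right j) hQp huv (h'.left_right_self j) hB hup hv'p hvp
      exact ⟨r₂, hr₂, hr₂u, hr₂v, fun i hi =>
        ⟨hr₂z _ (h'.left_left _ _) (hev i hi) (h'.left_right_of_ne i j (hne i hi)) (hpe i hi).1,
          hr₂z _ (hfe' i j (hne i hi)) (hfv i hi) (h'.right_right _ _) (hpe i hi).2⟩⟩
    refine ⟨r₂ * (r₁ * r), mul_mem hr₂ (mul_mem hr₁ hr), fun i hi => ?_⟩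
    simp only [End.mul_apply]
    rcases Nat.lt_succ_iff_lt_or_eq.1 hi with hi | hi
    · rw [(hri i hi).1, (hri i hi).2, hr₁e i hi, hr₁f i hi]
      exact hr₂z i hi
    · have : i = j := Fin.ext hi
      rw [this, hr₁u, hr₂u, ← hv, hr₂v]
      exact ⟨rfl, rfl⟩

end Reflections

/-! ### The Clifford group in characteristic two -/

section Clifford

open CliffordAlgebra

variable {F : Type*} [Field F] {E : Type*} [AddCommGroup E] [Module F E] {Q : QuadraticForm F E}

/-- The unit `x` of the Clifford algebra induces `r` on vectors: `x v x⁻¹ = r(v)`. -/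
def Induces (x : (CliffordAlgebra Q)ˣ) (r : End F E) : Prop :=
  ∀ v, (x : CliffordAlgebra Q) * ι Q v = ι Q (r v) * x

theorem Induces.mul {x y : (CliffordAlgebra Q)ˣ} {r s : End F E} (hx : Induces x r)
    (hy : Induces y s) : Induces (x * y) (r * s) := fun v => by
  rw [Units.val_mul, mul_assoc, hy, ← mul_assoc, hx, mul_assoc, End.mul_apply]

theorem induces_one : Induces (1 : (CliffordAlgebra Q)ˣ) 1 := fun v => by simp

theorem Induces.conj_eq {x : (CliffordAlgebra Q)ˣ} {r : End F E} (hx : Induces x r) (v : E) :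
    (x : CliffordAlgebra Q) * ι Q v * ((x⁻¹ : (CliffordAlgebra Q)ˣ) : CliffordAlgebra Q) =
      ι Q (r v) := by
  rw [hx v, Units.mul_inv_cancel_right]

theorem neg_eq_self_of_module (F : Type*) [Field F] [CharP F 2] {M : Type*} [AddCommGroup M]
    [Module F M] (x : M) : -x = x := by
  rw [← neg_one_smul F x, CharTwo.neg_eq, one_smul]

theorem induces_reflection [CharP F 2] {x : (CliffordAlgebra Q)ˣ} {w : E} (hw : Q w ≠ 0)
    (hx : (x : CliffordAlgebra Q) = ι Q w) : Induces x (reflection Q w) := by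
  intro v
  have h : ((Q w)⁻¹ * Q.polarBilin w v) • algebraMap F (CliffordAlgebra Q) (Q w) =
      algebraMap F (CliffordAlgebra Q) (QuadraticMap.polar Q w v) := by
    rw [Algebra.smul_def, ← map_mul, mul_right_comm, inv_mul_cancel₀ hw, one_mul,
      QuadraticMap.polarBilin_apply_apply]
  rw [hx, reflection_apply, map_sub, map_smul, sub_mul, smul_mul_assoc, ι_sq_scalar,
    ι_mul_ι_comm, h, ← neg_sub, neg_eq_self_of_module F]

/-- Elements of the Clifford group (of even or odd degree) act on the vectors. -/
theorem exists_induces_of_mem_lipschitzGroup [CharP F 2] [Nontrivial (CliffordAlgebra Q)]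
    {g : (CliffordAlgebra Q)ˣ} (hg : g ∈ lipschitzGroup Q) : ∃ s : End F E, Induces g s := by
  have hgen : ∀ x : (CliffordAlgebra Q)ˣ, ∀ w, ι Q w = (x : CliffordAlgebra Q) → Q w ≠ 0 := by
    intro x w hw h0
    have h1 := ι_sq_scalar Q w
    rw [h0, map_zero, hw, ← Units.val_mul] at h1
    exact Units.ne_zero _ h1
  induction hg using Subgroup.closure_induction'' with
  | mem x hx =>
    obtain ⟨w, hw⟩ := hx
    exact ⟨_, induces_reflection (hgen x w hw) hw.symm⟩
  | inv_mem x hx =>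
    obtain ⟨w, hw⟩ := hx
    refine ⟨reflection Q w, fun v => ?_⟩
    have h := induces_reflection (hgen x w hw) hw.symm (reflection Q w v)
    rw [reflection_reflection (hgen x w hw)] at h
    rw [Units.inv_mul_eq_iff_eq_mul, ← mul_assoc, h, Units.mul_inv_cancel_right]
  | one => exact ⟨1, induces_one⟩
  | mul x y _ _ hx hy =>
    obtain ⟨r, hr⟩ := hx
    obtain ⟨s, hs⟩ := hy
    exact ⟨r * s, hr.mul hs⟩

/-- A vector of norm `1` as a unit of the Clifford algebra. -/
def vectorUnit (w : E) (hw : Q w = 1) : (CliffordAlgebra Q)ˣ where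
  val := ι Q w
  inv := ι Q w
  val_inv := by rw [ι_sq_scalar, hw, map_one]
  inv_val := by rw [ι_sq_scalar, hw, map_one]

/-- The conditions for membership in the pin group, together with homogeneity. -/
def IsHomogeneousPin (x : (CliffordAlgebra Q)ˣ) : Prop :=
  (x : CliffordAlgebra Q) ∈ pinGroup Q ∧ ∃ i : ZMod 2, (x : CliffordAlgebra Q) ∈ evenOdd Q i

theorem isHomogeneousPin_vectorUnit [CharP F 2] (w : E) (hw : Q w = 1) :
    IsHomogeneousPin (vectorUnit w hw) := by
  have h : star (ι Q w) = ι Q w := by rw [star_ι, neg_eq_self_of_module F]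
  refine ⟨pinGroup.units_mem_iff.2 ⟨Subgroup.subset_closure ⟨w, rfl⟩, ?_⟩, 1,
    ι_mem_evenOdd_one Q w⟩
  rw [Unitary.mem_iff]
  exact ⟨by change star (ι Q w) * ι Q w = 1; rw [h, ι_sq_scalar, hw, map_one],
    by change ι Q w * star (ι Q w) = 1; rw [h, ι_sq_scalar, hw, map_one]⟩

theorem IsHomogeneousPin.mul {x y : (CliffordAlgebra Q)ˣ} (hx : IsHomogeneousPin x)
    (hy : IsHomogeneousPin y) : IsHomogeneousPin (x * y) := by
  obtain ⟨hx, i, hi⟩ := hx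
  obtain ⟨hy, j, hj⟩ := hy
  exact ⟨mul_mem hx hy, i + j, SetLike.mul_mem_graded hi hj⟩

theorem exists_isHomogeneousPin_induces [CharP F 2] {r : End F E} (hr : r ∈ reflectionMonoid Q) :
    ∃ x : (CliffordAlgebra Q)ˣ, IsHomogeneousPin x ∧ Induces x r := by
  induction hr using Submonoid.closure_induction with
  | mem r hr =>
    obtain ⟨w, hw, rfl⟩ := hr
    exact ⟨_, isHomogeneousPin_vectorUnit w hw,
      induces_reflection (by rw [hw]; exact one_ne_zero) rfl⟩
  | one => exact ⟨1, ⟨one_mem _, 0, SetLike.one_mem_graded _⟩, induces_one⟩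
  | mul r s _ _ hr hs =>
    obtain ⟨x, hx, hx'⟩ := hr
    obtain ⟨y, hy, hy'⟩ := hs
    exact ⟨x * y, hx.mul hy, hx'.mul hy'⟩

theorem mem_units_spinGroup_of_even {x : (CliffordAlgebra Q)ˣ}
    (hx : (x : CliffordAlgebra Q) ∈ pinGroup Q) (h0 : (x : CliffordAlgebra Q) ∈ evenOdd Q 0) :
    x ∈ (spinGroup Q).units := by
  have h : (x : CliffordAlgebra Q) ∈ spinGroup Q := by
    refine ⟨hx, ?_⟩
    rw [← even_toSubmodule] at h0
    exact h0
  refine ⟨h, ?_⟩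
  have hinv : ((x⁻¹ : (CliffordAlgebra Q)ˣ) : CliffordAlgebra Q) = star (x : CliffordAlgebra Q) :=
    Units.inv_eq_of_mul_eq_one_right (pinGroup.mul_star_self_of_mem hx)
  change ((x⁻¹ : (CliffordAlgebra Q)ˣ) : CliffordAlgebra Q) ∈ spinGroup Q
  rw [hinv]
  exact spinGroup.star_mem h

theorem Induces.isometry [Nontrivial (CliffordAlgebra Q)] {g : (CliffordAlgebra Q)ˣ}
    {s : End F E} (hg : Induces g s) (v : E) : Q (s v) = Q v := by
  apply (algebraMap F (CliffordAlgebra Q)).injective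
  rw [← ι_sq_scalar, ← ι_sq_scalar, ← hg.conj_eq v]
  simp only [mul_assoc, Units.inv_mul_cancel_left]
  rw [← mul_assoc (ι Q v), ι_sq_scalar, Algebra.commutes, Units.mul_inv_cancel_left]

/-- A semisimple element of the pin group acts semisimply on the vectors: left multiplication by
`g` and right multiplication by `g⁻¹`, its conjugate under the involution, are semisimple and
commute. -/
theorem Induces.isSemisimple [PerfectField F] [FiniteDimensional F (CliffordAlgebra Q)]
    (hι : Function.Injective (ι Q)) {g : (CliffordAlgebra Q)ˣ} {s : End F E} (hg : Induces g s)
    (hpin : (g : CliffordAlgebra Q) ∈ pinGroup Q) (hs : IsSemisimpleElement F g) :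
    s.IsSemisimple := by
  have hinv : ((g⁻¹ : (CliffordAlgebra Q)ˣ) : CliffordAlgebra Q) = star (g : CliffordAlgebra Q) :=
    Units.inv_eq_of_mul_eq_one_right (pinGroup.mul_star_self_of_mem hpin)
  let L : End F (CliffordAlgebra Q) := LinearMap.mulLeft F (g : CliffordAlgebra Q)
  let R : End F (CliffordAlgebra Q) :=
    LinearMap.mulRight F ((g⁻¹ : (CliffordAlgebra Q)ˣ) : CliffordAlgebra Q)
  let φ : CliffordAlgebra Q →ₗ[F] CliffordAlgebra Q :=
    { toFun := star, map_add' := star_add, map_smul' := star_smul }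
  have hL : L.IsSemisimple := hs
  have hR : R.IsSemisimple := by
    refine Module.End.isSemisimple_of_squarefree_aeval_eq_zero hL.minpoly_squarefree ?_
    ext x
    have h := apply_aeval_of_intertwining (f := L) (f' := R) φ (fun x => by
      change star ((g : CliffordAlgebra Q) * x) = star x * _
      rw [star_mul, hinv]) (minpoly F L) (star x)
    rw [minpoly.aeval] at h
    change star (0 : CliffordAlgebra Q) = Polynomial.aeval R _ (star (star x)) at h
    rw [star_star, star_zero] at h
    exact h.symm
  have hC : (L * R).IsSemisimple := hL.mul_of_commute (LinearMap.commute_mulLeft_right _ _) hR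
  refine Module.End.isSemisimple_of_squarefree_aeval_eq_zero hC.minpoly_squarefree ?_
  ext v
  apply hι
  rw [apply_aeval_of_intertwining (f := s) (f' := L * R) (ι Q) (fun v => by
    rw [← hg.conj_eq v, mul_assoc]; rfl), minpoly.aeval]
  simp

/-- The ring `A` with scalars acting through an endomorphism `φ` of the field. -/
def Twisted {F : Type*} [Field F] (_φ : F →+* F) (A : Type*) : Type _ := A

instance {F : Type*} [Field F] (φ : F →+* F) (A : Type*) [Ring A] : Ring (Twisted φ A) :=
  inferInstanceAs (Ring A)

instance {F : Type*} [Field F] (φ : F →+* F) (A : Type*) [Ring A] [Algebra F A] :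
    Algebra F (Twisted φ A) :=
  RingHom.toAlgebra' (S := Twisted φ A) ((algebraMap F A).comp φ)
    fun c x => Algebra.commutes (A := A) (φ c) x

/-- A semilinear map compatible with the quadratic form extends to the Clifford algebra. -/
theorem exists_ringHom_of_semilinear (φ : F →+* F) (τ : E →ₛₗ[φ] E)
    (hτ : ∀ v, Q (τ v) = φ (Q v)) :
    ∃ Φ : CliffordAlgebra Q →+* CliffordAlgebra Q,
      (∀ c, Φ (algebraMap F _ c) = algebraMap F _ (φ c)) ∧ ∀ v, Φ (ι Q v) = ι Q (τ v) := by
  let f : E →ₗ[F] Twisted φ (CliffordAlgebra Q) :=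
    { toFun := fun v => ι Q (τ v)
      map_add' := fun v w => by
        rw [map_add, map_add]; rfl
      map_smul' := fun c v => by
        rw [map_smulₛₗ, map_smul, Algebra.smul_def]; rfl }
  have hf : ∀ v, f v * f v = algebraMap F (Twisted φ (CliffordAlgebra Q)) (Q v) := fun v => by
    change ι Q (τ v) * ι Q (τ v) = algebraMap F (CliffordAlgebra Q) (φ (Q v))
    rw [ι_sq_scalar, hτ]
  let Ψ := CliffordAlgebra.lift Q ⟨f, hf⟩
  exact ⟨Ψ.toRingHom, fun c => Ψ.commutes c, fun v => CliffordAlgebra.lift_ι_apply f hf v⟩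

theorem finite_exteriorAlgebra [FiniteDimensional F E] :
    FiniteDimensional F (ExteriorAlgebra F E) := by
  refine Module.finite_def.2 ?_
  have h : (⊤ : Submodule F (ExteriorAlgebra F E)) =
      ⨆ i : Fin (finrank F E + 1), ⋀[F]^(i : ℕ) E := by
    refine le_antisymm ?_ le_top
    rw [← CliffordAlgebra.iSup_ι_range_eq_top (0 : QuadraticForm F E)]
    refine iSup_le fun i => ?_
    change ⋀[F]^i E ≤ _
    by_cases hi : i < finrank F E + 1
    · exact le_iSup (fun i : Fin (finrank F E + 1) => ⋀[F]^(i : ℕ) E) ⟨i, hi⟩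
    · have h0 : finrank F (⋀[F]^i E) = 0 := by
        rw [exteriorPower.finrank_eq, Nat.choose_eq_zero_of_lt (by omega)]
      rw [Submodule.finrank_eq_zero.1 h0]
      exact bot_le
  rw [h]
  exact Submodule.fg_iSup _ fun i => Module.Finite.iff_fg.1 inferInstance

end Clifford

/-! ### Spin groups -/

section TypeD

open CliffordAlgebra

variable {F : Type*} [Field F] {n : ℕ}

theorem ι_splitForm_injective : Function.Injective (ι (splitForm F n)) := by
  rw [injective_iff_map_eq_zero]
  intro v hv
  by_contra h
  exact ι_ne_zero F n h hv

theorem nontrivial_Cl (i : Fin n) : Nontrivial (Cl F n) := ⟨⟨_, _, vecE_ne_zero i⟩⟩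

theorem finiteDimensional_Cl : FiniteDimensional F (Cl F n) := by
  have h : LinearMap.BilinMap.toQuadraticMap (-(splitBilin F n)) = 0 - splitForm F n := by
    ext w
    simp [splitBilin, splitForm_apply]
  have : FiniteDimensional F (CliffordAlgebra (0 : QuadraticForm F ((Fin n → F) × (Fin n → F)))) :=
    finite_exteriorAlgebra
  exact LinearEquiv.finiteDimensional (changeFormEquiv h).symm

theorem polarBilin_splitForm (x y : (Fin n → F) × (Fin n → F)) :
    (splitForm F n).polarBilin x y = ∑ i, (x.1 i * y.2 i + y.1 i * x.2 i) := by
  rw [QuadraticMap.polarBilin_apply_apply, QuadraticMap.polar, splitForm_apply, splitForm_apply,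
    splitForm_apply, ← Finset.sum_sub_distrib, ← Finset.sum_sub_distrib]
  refine Finset.sum_congr rfl fun i _ => ?_
  simp only [Prod.fst_add, Prod.snd_add, Pi.add_apply]
  ring

/-- The standard basis of `F^{2n}` is hyperbolic for the split form. -/
theorem isHyperbolicBasis_single : IsHyperbolicBasis (splitForm F n).polarBilin (splitForm F n)
    (fun i => (Pi.single i 1, 0)) (fun i => (0, Pi.single i 1)) where
  map_left i := by simp [splitForm_apply]
  map_right i := by simp [splitForm_apply]
  left_left i j := by rw [polarBilin_splitForm]; simp
  right_right i j := by rw [polarBilin_splitForm]; simp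
  left_right_self i := by rw [polarBilin_splitForm]; simp [Pi.single_apply]
  left_right_of_ne i j hij := by rw [polarBilin_splitForm]; simp [Pi.single_apply, hij.symm]
  eq_zero x h₁ h₂ := by
    simp only [polarBilin_splitForm] at h₁ h₂
    ext i
    · simpa [Pi.single_apply] using h₂ i
    · simpa [Pi.single_apply] using h₁ i

/-- If `x` carries the standard basis to eigenvectors of `g`, then `x⁻¹ g x` is in the torus, and
the characters `ε_i` take the eigenvalues as values. -/
theorem exists_torusD_of_induces {g x : groupD F n}
    {s r : End F ((Fin n → F) × (Fin n → F))} (hg : Induces (g : (Cl F n)ˣ) s)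
    (hx : Induces (x : (Cl F n)ˣ) r) {a : Fin n → Fˣ}
    (he : ∀ i, s (r (Pi.single i 1, 0)) = (a i : F) • r (Pi.single i 1, 0))
    (hf : ∀ i, s (r (0, Pi.single i 1)) = (((a i)⁻¹ : Fˣ) : F) • r (0, Pi.single i 1)) :
    ∃ t : torusD F n, g * x = x * t ∧ ∀ i, (epsD F n i).toMul t = a i := by
  have key : ∀ (v : (Fin n → F) × (Fin n → F)) (c : F), s (r v) = c • r v →
      (((x⁻¹ * g * x : groupD F n) : (Cl F n)ˣ) : Cl F n) * ι (splitForm F n) v *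
        ((((x⁻¹ * g * x : groupD F n) : (Cl F n)ˣ)⁻¹ : (Cl F n)ˣ) : Cl F n) =
      c • ι (splitForm F n) v := by
    intro v c hv
    have hxv : (((x⁻¹ : groupD F n) : (Cl F n)ˣ) : Cl F n) * ι (splitForm F n) (r v) =
        ι (splitForm F n) v * (((x⁻¹ : groupD F n) : (Cl F n)ˣ) : Cl F n) := by
      rw [Subgroup.coe_inv, Units.inv_mul_eq_iff_eq_mul, ← mul_assoc, hx v,
        Units.mul_inv_cancel_right]
    rw [Units.mul_inv_eq_iff_eq_mul]
    simp only [Subgroup.coe_mul, Units.val_mul]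
    calc _ = (((x⁻¹ : groupD F n) : (Cl F n)ˣ) : Cl F n) * (((g : (Cl F n)ˣ) : Cl F n) *
          (((x : (Cl F n)ˣ) : Cl F n) * ι (splitForm F n) v)) := by simp only [mul_assoc]
      _ = c • ((((x⁻¹ : groupD F n) : (Cl F n)ˣ) : Cl F n) * ι (splitForm F n) (r v) *
          (((g : (Cl F n)ˣ) : Cl F n) * ((x : (Cl F n)ˣ) : Cl F n))) := by
        rw [hx v, ← mul_assoc ((g : (Cl F n)ˣ) : Cl F n), hg, hv, map_smul]
        simp only [smul_mul_assoc, mul_smul_comm, mul_assoc]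
      _ = _ := by rw [hxv]; simp only [smul_mul_assoc, mul_assoc]
  have key₁ := fun i => key _ _ (he i)
  have key₂ := fun i => key _ _ (hf i)
  refine ⟨⟨x⁻¹ * g * x, fun i => ⟨a i, key₁ i, key₂ i⟩⟩, by simp [mul_assoc], fun i => ?_⟩
  exact torusD_eigenvalue_unique (epsD_spec F n i _) (key₁ i)

/-- A hyperbolic basis of eigenvectors is induced by an element of the spin group, possibly after
the exchange of the vectors of one chosen pair. -/
theorem exists_groupD_induces [IsAlgClosed F] [CharP F 2]
    {s : End F ((Fin n → F) × (Fin n → F))} {e f : Fin n → (Fin n → F) × (Fin n → F)}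
    {a : Fin n → Fˣ}
    (h : IsHyperbolicEigenbasis (splitForm F n).polarBilin (splitForm F n) s e f a) (l : Fin n) :
    ∃ (x : groupD F n) (r : End F ((Fin n → F) × (Fin n → F))) (a' : Fin n → Fˣ),
      Induces (x : (Cl F n)ˣ) r ∧ (∀ i, i ≠ l → a' i = a i) ∧
      (∀ i, s (r (Pi.single i 1, 0)) = (a' i : F) • r (Pi.single i 1, 0)) ∧
      (∀ i, s (r (0, Pi.single i 1)) = (((a' i)⁻¹ : Fˣ) : F) • r (0, Pi.single i 1)) := by
  have h₀ := isHyperbolicBasis_single (F := F) (n := n)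
  obtain ⟨r, hr, hri⟩ := exists_reflectionMonoid_apply_eq h₀ h.toIsHyperbolicBasis
  obtain ⟨x, ⟨hx, i, hi⟩, hxr⟩ := exists_isHomogeneousPin_induces hr
  have hre : ∀ i, r (Pi.single i 1, 0) = e i := fun i => (hri i).1
  have hrf : ∀ i, r (0, Pi.single i 1) = f i := fun i => (hri i).2
  obtain rfl | rfl : i = 0 ∨ i = 1 :=
    (by decide : ∀ j : ZMod 2, j = 0 ∨ j = 1) i
  · exact ⟨⟨x, mem_units_spinGroup_of_even hx hi⟩, r, a, hxr, fun _ _ => rfl,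
      fun i => by rw [hre, h.apply_left], fun i => by rw [hrf, h.apply_right]⟩
  -- `x` is odd: it is corrected by the reflection exchanging the two vectors of the pair `l`
  let w : (Fin n → F) × (Fin n → F) := (Pi.single l 1, Pi.single l 1)
  have hw : splitForm F n w = 1 := by simp [w, splitForm_apply, Pi.single_apply]
  have hp := isHomogeneousPin_vectorUnit w hw
  have hwe : ∀ i, r (reflection (splitForm F n) w (Pi.single i 1, 0)) =
      if i = l then f i else e i := by
    intro i
    have hB : (splitForm F n).polarBilin w (Pi.single i 1, 0) = if i = l then 1 else 0 := by
      rw [polarBilin_splitForm]; simp [w, Pi.single_apply, eq_comm]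
    rw [reflection_apply, hw, hB]
    split_ifs with hil
    · have : ((Pi.single i 1, 0) : (Fin n → F) × (Fin n → F)) - w = -(0, Pi.single i 1) := by
        rw [hil]; ext j <;> simp [w]
      rw [inv_one, mul_one, one_smul, this, map_neg, hrf, neg_eq_self_of_module F]
    · rw [mul_zero, zero_smul, sub_zero, hre]
  have hwf : ∀ i, r (reflection (splitForm F n) w (0, Pi.single i 1)) =
      if i = l then e i else f i := by
    intro i
    have hB : (splitForm F n).polarBilin w (0, Pi.single i 1) = if i = l then 1 else 0 := by
      rw [polarBilin_splitForm]; simp [w, Pi.single_apply, eq_comm]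
    rw [reflection_apply, hw, hB]
    split_ifs with hil
    · have : ((0, Pi.single i 1) : (Fin n → F) × (Fin n → F)) - w = -(Pi.single i 1, 0) := by
        rw [hil]; ext j <;> simp [w]
      rw [inv_one, mul_one, one_smul, this, map_neg, hre, neg_eq_self_of_module F]
    · rw [mul_zero, zero_smul, sub_zero, hrf]
  refine ⟨⟨x * vectorUnit w hw, mem_units_spinGroup_of_even (mul_mem hx hp.1)
    (SetLike.mul_mem_graded (i := (1 : ZMod 2)) (j := 1) hi (ι_mem_evenOdd_one _ w))⟩,
    r * reflection (splitForm F n) w, Function.update a l (a l)⁻¹,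
    hxr.mul (induces_reflection (by rw [hw]; exact one_ne_zero) rfl),
    fun i hil => Function.update_of_ne hil _ _, fun i => ?_, fun i => ?_⟩
  · rw [End.mul_apply, hwe]
    split_ifs with hil
    · subst hil; rw [Function.update_self, h.apply_right]
    · rw [Function.update_of_ne hil, h.apply_left]
  · rw [End.mul_apply, hwf]
    split_ifs with hil
    · subst hil; rw [Function.update_self, inv_inv, h.apply_left]
    · rw [Function.update_of_ne hil, h.apply_right]

/-- The statement for spin groups, for the `𝔽_q`-structure given by a semilinear map `τ` that
induces the `q`-th power on the values of the quadratic form and fixes `W`. -/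
theorem hasEigenvalue_one_typeD_of_semilinear [IsAlgClosed F] [CharP F 2] {V : Type*}
    [AddCommGroup V] [Module F V] (hn : 3 < n) {q : ℕ} (hq : 1 ≤ q) (φ : F →+* F)
    (hφ : ∀ x, φ x = x ^ q) (τ : ((Fin n → F) × (Fin n → F)) →ₛₗ[φ] ((Fin n → F) × (Fin n → F)))
    (hτ : ∀ v, splitForm F n (τ v) = φ (splitForm F n v)) (hτ0 : ∀ v, τ v = 0 → v = 0)
    {W : Set ((Fin n → F) × (Fin n → F))} (hW : ∀ v ∈ W, τ v = v)
    (ρ : Representation F (groupD F n) V) {m₁ m₂ m₃ : ℕ}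
    (hw₁ : IsWeight (torusD F n) ρ (m₁ • (q + 1) • omegaD F n 1))
    (hw₂ : IsWeight (torusD F n) ρ (m₂ • (q - 1) • omegaD F n 1))
    (hw₃ : IsWeight (torusD F n) ρ (m₃ • ((q - 1) • omegaD F n 1 + omegaD F n 2)))
    {g : groupD F n} (hg : g ∈ finiteSpin F n q W) (hs : IsSemisimpleElement F g.1) :
    Module.End.HasEigenvalue (ρ g) 1 := by
  have : Nontrivial (Cl F n) := nontrivial_Cl ⟨0, by omega⟩
  have : FiniteDimensional F (Cl F n) := finiteDimensional_Cl
  have hpin : ((g : (Cl F n)ˣ) : Cl F n) ∈ pinGroup (splitForm F n) := g.2.1.1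
  obtain ⟨s, hgs⟩ := exists_induces_of_mem_lipschitzGroup (pinGroup.units_mem_iff.1 hpin).1
  have hss := hgs.isSemisimple ι_splitForm_injective hpin hs
  obtain ⟨Φ, hΦc, hΦι⟩ := exists_ringHom_of_semilinear φ τ hτ
  have hΦg : Φ ((g : (Cl F n)ˣ) : Cl F n) = ((g : (Cl F n)ˣ) : Cl F n) := by
    have hle : rationalClifford F n q W ≤ RingHom.eqLocus Φ (RingHom.id _) := by
      refine Subring.closure_le.2 ?_
      rintro _ (⟨c, hc, rfl⟩ | ⟨v, hv, rfl⟩)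
      · change Φ _ = _
        rw [hΦc, hφ, hc]
        rfl
      · change Φ _ = _
        rw [hΦι, hW v hv]
        rfl
    exact hle hg
  have hsB := polarBilin_map_of_map hgs.isometry
  obtain ⟨e, f, a, h⟩ := exists_isHyperbolicEigenbasis n (by simp [two_mul]) hss
    (isAlt_polarBilin (splitForm F n))
    (fun x hx => isHyperbolicBasis_single.eq_zero x (fun _ => hx _) fun _ => hx _) hsB
    (Or.inr rfl) hgs.isometry
  -- `Φ` maps eigenvectors of `g` to eigenvectors
  obtain ⟨e, f, a, h, ha⟩ := h.exists_frobenius_ordered (by omega)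
    (isAlt_polarBilin (splitForm F n)) hsB (q := q) (by
      intro c v hv hsv
      refine ⟨τ v, fun h0 => hv (hτ0 v h0), ι_splitForm_injective ?_⟩
      have h1 := congrArg Φ (hgs v)
      rw [hsv, map_mul, hΦg, hΦι, hgs (τ v), map_mul, hΦg, hΦι, map_smulₛₗ, hφ] at h1
      exact (Units.mul_left_inj _).1 h1)
  obtain ⟨x, r, a', hx, haa', he, hf⟩ := exists_groupD_induces h ⟨n - 1, by omega⟩
  obtain ⟨t, hgt, ht⟩ := exists_torusD_of_induces hgs hx he hf
  refine hasEigenvalue_one_of_frobenius_relation (by omega) hq hw₁ hw₂ hw₃ t hgt (ht _) (ht _) ?_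
  rw [haa' _ (by rw [Ne, Fin.mk.injEq]; omega), haa' _ (by rw [Ne, Fin.mk.injEq]; omega)]
  exact ha

/-- The semilinear map of `F^{2n}` that applies `φ` to the coordinates, and exchanges the
coordinates of the hyperbolic pairs in `P`. -/
def swapSemilinear (φ : F →+* F) (P : Fin n → Prop) [DecidablePred P] :
    ((Fin n → F) × (Fin n → F)) →ₛₗ[φ] ((Fin n → F) × (Fin n → F)) where
  toFun v := (fun i => φ (if P i then v.2 i else v.1 i), fun i => φ (if P i then v.1 i else v.2 i))
  map_add' v w := by
    ext i <;> by_cases h : P i <;> simp [h]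
  map_smul' c v := by
    ext i <;> by_cases h : P i <;> simp [h]

theorem splitForm_swapSemilinear (φ : F →+* F) (P : Fin n → Prop) [DecidablePred P]
    (v : (Fin n → F) × (Fin n → F)) :
    splitForm F n (swapSemilinear φ P v) = φ (splitForm F n v) := by
  rw [splitForm_apply, splitForm_apply, map_sum]
  refine Finset.sum_congr rfl fun i _ => ?_
  by_cases h : P i <;> simp [swapSemilinear, h, mul_comm]

theorem eq_zero_of_swapSemilinear_eq_zero (φ : F →+* F) (P : Fin n → Prop) [DecidablePred P]
    (v : (Fin n → F) × (Fin n → F)) (hv : swapSemilinear φ P v = 0) : v = 0 := by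
  have h₁ := fun i => congrFun (congrArg Prod.fst hv) i
  have h₂ := fun i => congrFun (congrArg Prod.snd hv) i
  simp only [swapSemilinear, LinearMap.coe_mk, AddHom.coe_mk, Prod.fst_zero, Prod.snd_zero,
    Pi.zero_apply, map_eq_zero] at h₁ h₂
  ext i
  · by_cases h : P i
    · simpa [h] using h₂ i
    · simpa [h] using h₁ i
  · by_cases h : P i
    · simpa [h] using h₁ i
    · simpa [h] using h₂ i

theorem hasEigenvalue_one_typeD [IsAlgClosed F] [CharP F 2] {V : Type*} [AddCommGroup V]
    [Module F V] (hn : 3 < n) {q k : ℕ} (hq : q = 2 ^ k) (ρ : Representation F (groupD F n) V)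
    {m₁ m₂ m₃ : ℕ}
    (hw₁ : IsWeight (torusD F n) ρ (m₁ • (q + 1) • omegaD F n 1))
    (hw₂ : IsWeight (torusD F n) ρ (m₂ • (q - 1) • omegaD F n 1))
    (hw₃ : IsWeight (torusD F n) ρ (m₃ • ((q - 1) • omegaD F n 1 + omegaD F n 2)))
    {g : groupD F n} (hg : g ∈ finiteDPlus F n q ∪ finiteDMinus F n q)
    (hs : IsSemisimpleElement F g.1) : Module.End.HasEigenvalue (ρ g) 1 := by
  let φ := iterateFrobenius F 2 k
  have hφ : ∀ x, φ x = x ^ q := fun x => by simp [φ, iterateFrobenius_def, hq]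
  have hq1 : 1 ≤ q := hq ▸ Nat.one_le_two_pow
  rcases hg with hg | hg
  · refine hasEigenvalue_one_typeD_of_semilinear hn hq1 φ hφ (swapSemilinear φ fun _ => False)
      (splitForm_swapSemilinear φ _) (eq_zero_of_swapSemilinear_eq_zero φ _) (fun v hv => ?_)
      ρ hw₁ hw₂ hw₃ hg hs
    ext i
    · simpa [swapSemilinear, hφ] using (hv i).1
    · simpa [swapSemilinear, hφ] using (hv i).2
  · refine hasEigenvalue_one_typeD_of_semilinear hn hq1 φ hφ
      (swapSemilinear φ fun i => (i : ℕ) + 1 = n)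
      (splitForm_swapSemilinear φ _) (eq_zero_of_swapSemilinear_eq_zero φ _) (fun v hv => ?_)
      ρ hw₁ hw₂ hw₃ hg hs
    ext i
    · have h := hv i
      by_cases hi : (i : ℕ) + 1 = n
      · rw [if_pos hi] at h
        simpa [swapSemilinear, hφ, hi] using h.2
      · rw [if_neg hi] at h
        simpa [swapSemilinear, hφ, hi] using h.1
    · have h := hv i
      by_cases hi : (i : ℕ) + 1 = n
      · rw [if_pos hi] at h
        simpa [swapSemilinear, hφ, hi] using h.1
      · rw [if_neg hi] at h
        simpa [swapSemilinear, hφ, hi] using h.2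

end TypeD

end Unisingular

theorem mainTheorem5 {F : Type*} [Field F] [IsAlgClosed F] [CharP F 2]
    {V : Type*} [AddCommGroup V] [Module F V] [FiniteDimensional F V]
    (q : ℕ) (hq : IsPrimePow q) (hq2 : Even q) :
    (∀ n : ℕ, 1 ≤ n → ∀ ρ : Representation F (groupA F n) V, IsRational ρ → ρ.IsIrreducible →
      (∃ m₁ m₂ i : ℕ, 1 ≤ i ∧ i ≤ n ∧
        IsWeight (torusA F n) ρ
          (m₁ • ((q - 1) • omegaA F n i + omegaA F n 1 + omegaA F n n)) ∧
        IsWeight (torusA F n) ρ (m₂ • (q - 1) • omegaA F n i)) →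
      ∀ g ∈ finiteA F n q, IsSemisimpleElement F g.1 → Module.End.HasEigenvalue (ρ g) 1) ∧
    (∀ n : ℕ, 1 < n → ∀ ρ : Representation F (groupC F n) V, IsRational ρ → ρ.IsIrreducible →
      (∃ m₁ m₂ m₃ : ℕ,
        IsWeight (torusC F n) ρ (m₁ • (q + 1) • omegaC F n 1) ∧
        IsWeight (torusC F n) ρ (m₂ • (q - 1) • omegaC F n 1) ∧
        IsWeight (torusC F n) ρ (m₃ • ((q - 1) • omegaC F n 1 + omegaC F n 2))) →
      ∀ g ∈ finiteC F n q, IsSemisimpleElement F g.1 → Module.End.HasEigenvalue (ρ g) 1) ∧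
    (∀ n : ℕ, 3 < n → ∀ ρ : Representation F (groupD F n) V, IsRational ρ → ρ.IsIrreducible →
      (∃ m₁ m₂ m₃ : ℕ,
        IsWeight (torusD F n) ρ (m₁ • (q + 1) • omegaD F n 1) ∧
        IsWeight (torusD F n) ρ (m₂ • (q - 1) • omegaD F n 1) ∧
        IsWeight (torusD F n) ρ (m₃ • ((q - 1) • omegaD F n 1 + omegaD F n 2))) →
      ∀ g ∈ finiteDPlus F n q ∪ finiteDMinus F n q,
        IsSemisimpleElement F g.1 → Module.End.HasEigenvalue (ρ g) 1) := by
  obtain ⟨k, rfl⟩ : ∃ k, q = 2 ^ k := by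
    obtain ⟨p, k, hp, hk, rfl⟩ := hq
    have h2 : p = 2 := (Nat.prime_dvd_prime_iff_eq Nat.prime_two hp.nat_prime).1
      (Nat.prime_two.dvd_of_dvd_pow hq2.two_dvd) |>.symm
    exact ⟨k, by rw [h2]⟩
  refine ⟨?_, ?_, ?_⟩
  · rintro n - ρ - - ⟨m₁, m₂, i, hi₁, hin, hw₁, hw₂⟩ g hg hs
    exact hasEigenvalue_one_typeA rfl ρ hi₁ hin hw₁ hw₂ hg hs
  · rintro n hn ρ - - ⟨m₁, m₂, m₃, hw₁, hw₂, hw₃⟩ g hg hs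
    exact hasEigenvalue_one_typeC hn rfl ρ hw₁ hw₂ hw₃ hg hs
  · rintro n hn ρ - - ⟨m₁, m₂, m₃, hw₁, hw₂, hw₃⟩ g hg hs
    exact hasEigenvalue_one_typeD hn rfl ρ hw₁ hw₂ hw₃ hg hs
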